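/- Let $\mathcal P=\{\mathcal P(n)\}_{n\ge 1}$ be a symmetric operad with identity operation $\mathrm{id}\in\mathcal P(1)$, composition $\gamma$ and right symmetric group actions $\mu\mapsto\mu^\sigma$. For a partition $\pi$ of $\{1,\dots,n\}$ order the elements of each block increasingly and the blocks by their minimal elements, let $k=|\pi|$, let $j_1,\dots,j_k$ be the sizes of the blocks, and let $\sigma_\pi$ be the permutation listing the elements of the blocks in this order (so $\gamma(g;f_1,\dots,f_k)^{\sigma_\pi}$ is $\gamma(g;f_1,\dots,f_k)$ with the inputs of $f_i$ labelled, in order, by the elements of the $i$-th block). For sequences $g=(g_n)_{n\ge1}$, $f=(f_n)_{n\ge 1}$ with $g_n,f_n\in\mathcal P(n)$ put $$(g\bullet f)_n=\sum_{\pi}\gamma(g_k;f_{j_1},\dots,f_{j_k})^{\sigma_\pi},\qquad (f*g)_n=\sum_{\emptyset\ne J\subseteq\{1,\dots,n\}}\gamma(g_k;\mathrm{id},\dots,\mathrm{id},f_{|J|},\mathrm{id},\dots,\mathrm{id})^{\sigma_{\pi_J}},$$ where $\pi$ runs over all partitions of $\{1,\dots,n\}$, $\pi_J=\{\{i\}: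 i\notin J\}\cup\{J\}$, $k$ is the number of blocks of the partition ($\pi$, respectively $\pi_J$), and $f_{|J|}$ stands at position $\min J$. Let $H(\mathcal P)=\{\mathrm{id}\}\times\prod_{n\ge2}\mathcal P(n)$ and $L(\mathcal P)=\{0\}\times\prod_{n\ge 2}\mathcal P(n)$. **Theorem.** (1) Let $\mathcal P$ be a symmetric operad in modules over any commutative ring. The product $*$ maps $L(\mathcal P)\times L(\mathcal P)$ bilinearly to $L(\mathcal P)$ and is (left) pre-Lie: $$(f*g)*h-f*(g*h)=(g*f)*h-g*(f*h).$$ Hence $[f,g]=f*g-g*f$ is a Lie bracket on $L(\mathcal P)$. Moreover, for $f,g\in L(\mathcal P)$, $(f*g)_n$ is the sub-sum of $\sum_\pi\gamma(g_k;\hat f_{j_1},\dots,\hat f_{j_k})^{\sigma_\pi}$ over the partitions $\pi$ of $\{1,\dots,n\}$ with exactly one non-singleton block, where $\hat f=(\mathrm{id},f_2,f_3,\dots)$ (and $g_1=0$). (2) Let $\mathcal P$ be a symmetric operad in finite dimensional vector spaces over $\mathbb R$ or $\mathbb C$. Then $H(\mathcal P)$ with the product $\bullet$ is a group, and for $m\ge1$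 its quotient by $H_m(\mathcal P)=\{f: f_2=\dots=f_m=0\}$, identified with $\prod_{n=2}^m\mathcal P(n)$ by truncation, is an analytic Lie group over that field. With the product topology $H(\mathcal P)$ is a topological group and is the inverse limit of these Lie groups (a pro-Lie group). Its Lie algebra, i.e. the inverse limit of the Lie algebras $T_1\bigl(H(\mathcal P)/H_m(\mathcal P)\bigr)$ along the differentials of the truncation maps, is $L(\mathcal P)$: the truncations give a linear isomorphism of $L(\mathcal P)$ onto this inverse limit, and under it $[f,g]=f*g-g*f$ is the bracket of right-invariant vector fields; equivalently, it is minus the bracket of left-invariant vector fields. -/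

import Mathlib

open scoped BigOperators Manifold ContDiff Topology

universe u v

/-! ### Symmetric operads -/

/-- The arity identity behind the associativity of operadic composition. -/
theorem sum_sum_finSigma {m : ℕ} (j : Fin m → ℕ) (r : Fin (∑ i, j i) → ℕ) :
    ∑ x, r x = ∑ i, ∑ l, r (finSigmaFinEquiv ⟨i, l⟩) := by
  rw [← Equiv.sum_comp finSigmaFinEquiv r, Fintype.sum_sigma]

/-- A symmetric operad (classical definition) in modules over a commutative ring `k`, on the spaces
`P n`.

* The `𝕊`-module structure is given as a functor on the groupoid with objects `Fin n` and morphisms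
  the bijections `Fin m ≃ Fin n` (these exist only for `m = n`, so this is the same as an action of
  every symmetric group, together with casts along equalities `m = n`): `map e μ` is the operation
  `μ` with its `p`-th input renamed `e p`.  For multilinear maps,
  `(map e μ)(x₁, …, xₙ) = μ(x_{e 1}, …, x_{e n})`.  The usual right action is `μ^σ = map σ⁻¹ μ`.
* `comp j μ ν` is the composition `γ(μ; ν₁, …, νₘ)`, `νᵢ` of arity `j i`; its inputs are the pairs
  `(i, l)`, `l` an input of `νᵢ`, in lexicographic order. -/
structure SymmetricOperad (k : Type*) [CommRing k] (P : ℕ → Type*) [∀ n, AddCommGroup (P n)]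
    [∀ n, Module k (P n)] where
  map : ∀ {m n : ℕ}, (Fin m ≃ Fin n) → P m →ₗ[k] P n
  map_refl : ∀ {n : ℕ} (μ : P n), map (Equiv.refl (Fin n)) μ = μ
  map_trans : ∀ {l m n : ℕ} (e : Fin l ≃ Fin m) (e' : Fin m ≃ Fin n) (μ : P l),
    map (e.trans e') μ = map e' (map e μ)
  /-- the identity operation -/
  one : P 1
  comp : ∀ {m : ℕ} (j : Fin m → ℕ),
    P m →ₗ[k] MultilinearMap k (fun i => P (j i)) (P (∑ i, j i))
  one_comp : ∀ {n : ℕ} (ν : P n),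
    map (finCongr (by simp)) (comp (fun _ : Fin 1 => n) one (fun _ => ν)) = ν
  comp_one : ∀ {m : ℕ} (μ : P m),
    map (finCongr (by simp)) (comp (fun _ : Fin m => 1) μ (fun _ => one)) = μ
  comp_assoc : ∀ {m : ℕ} (j : Fin m → ℕ) (r : Fin (∑ i, j i) → ℕ) (μ : P m)
    (ν : ∀ i, P (j i)) (ξ : ∀ x, P (r x)),
    map (finCongr (sum_sum_finSigma j r)) (comp r (comp j μ ν) ξ) =
      comp (fun i => ∑ l, r (finSigmaFinEquiv ⟨i, l⟩)) μ
        (fun i => comp (fun l => r (finSigmaFinEquiv ⟨i, l⟩)) (ν i)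
          (fun l => ξ (finSigmaFinEquiv ⟨i, l⟩)))
  /-- equivariance in the outer operation -/
  map_comp : ∀ {m m' : ℕ} (e : Fin m ≃ Fin m') (j : Fin m' → ℕ) (μ : P m) (ν : ∀ i, P (j i)),
    comp j (map e μ) ν =
      map (finSigmaFinEquiv.symm.trans
          ((Equiv.sigmaCongrLeft (β := fun i => Fin (j i)) e).trans finSigmaFinEquiv))
        (comp (fun i => j (e i)) μ (fun i => ν (e i)))
  /-- equivariance in the inner operations -/
  comp_map : ∀ {m : ℕ} (j j' : Fin m → ℕ) (e : ∀ i, Fin (j i) ≃ Fin (j' i)) (μ : P m)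
    (ν : ∀ i, P (j i)),
    comp j' μ (fun i => map (e i) (ν i)) =
      map (finSigmaFinEquiv.symm.trans ((Equiv.sigmaCongrRight e).trans finSigmaFinEquiv))
        (comp j μ ν)

/-! ### Partitions of `{1, …, n}` in canonical order -/

/-- Partitions of `{1, …, n}`. -/
abbrev SetPart (n : ℕ) : Type := Finpartition (Finset.univ : Finset (Fin n))

namespace SetPart

variable {n : ℕ} (π : SetPart n)

/-- The minimal elements of the blocks. -/
def minima : Finset (Fin n) := Finset.univ.filter fun a => ∀ b ∈ π.part a, a ≤ b

/-- The number of blocks. -/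
def numBlocks : ℕ := π.minima.card

/-- The `i`-th block, the blocks being ordered by their minimal elements. -/
def block (i : Fin π.numBlocks) : Finset (Fin n) := π.part (π.minima.orderEmbOfFin rfl i)

/-- The cardinality of the `i`-th block. -/
def size (i : Fin π.numBlocks) : ℕ := (π.block i).card

/-- The `l`-th element of the `i`-th block, in increasing order. -/
def elem (x : Σ i : Fin π.numBlocks, Fin (π.size i)) : Fin n :=
  (π.block x.1).orderEmbOfFin rfl x.2

theorem elem_bijective : Function.Bijective π.elem := by
  constructor
  · rintro ⟨i, l⟩ ⟨i', l'⟩ h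
    have h1 : π.elem ⟨i, l⟩ ∈ π.block i := Finset.orderEmbOfFin_mem _ _ _
    have h2 : π.elem ⟨i', l'⟩ ∈ π.block i' := Finset.orderEmbOfFin_mem _ _ _
    have hb : π.block i = π.block i' :=
      π.eq_of_mem_parts (π.part_mem.2 (Finset.mem_univ _)) (π.part_mem.2 (Finset.mem_univ _))
        h1 (h ▸ h2)
    have hi : i = i' := by
      have m1 : π.minima.orderEmbOfFin rfl i ∈ π.minima := Finset.orderEmbOfFin_mem _ _ _
      have m2 : π.minima.orderEmbOfFin rfl i' ∈ π.minima := Finset.orderEmbOfFin_mem _ _ _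
      have s1 : π.minima.orderEmbOfFin rfl i ∈ π.block i := π.mem_part (Finset.mem_univ _)
      have s2 : π.minima.orderEmbOfFin rfl i' ∈ π.block i' := π.mem_part (Finset.mem_univ _)
      have l1 := (Finset.mem_filter.1 m1).2 _ (show _ ∈ π.block i from hb ▸ s2)
      have l2 := (Finset.mem_filter.1 m2).2 _ (show _ ∈ π.block i' from hb ▸ s1)
      exact (π.minima.orderEmbOfFin rfl).injective (le_antisymm l1 l2)
    subst hi
    have hl : l = l' := ((π.block i).orderEmbOfFin rfl).injective h
    rw [hl]
  · intro a
    have hne : (π.part a).Nonempty := ⟨a, π.mem_part (Finset.mem_univ _)⟩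
    have hp : π.part ((π.part a).min' hne) = π.part a :=
      π.part_eq_of_mem (π.part_mem.2 (Finset.mem_univ _)) (Finset.min'_mem _ _)
    have hm : (π.part a).min' hne ∈ π.minima :=
      Finset.mem_filter.2 ⟨Finset.mem_univ _, fun b hb => Finset.min'_le _ _ (hp ▸ hb)⟩
    obtain ⟨i, hi⟩ : (π.part a).min' hne ∈ Set.range (π.minima.orderEmbOfFin rfl) := by
      rw [Finset.range_orderEmbOfFin]; exact hm
    have ha : a ∈ π.block i := by
      unfold block
      rw [hi, hp]
      exact π.mem_part (Finset.mem_univ _)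
    obtain ⟨l, hl⟩ : a ∈ Set.range ((π.block i).orderEmbOfFin rfl) := by
      rw [Finset.range_orderEmbOfFin]; exact ha
    exact ⟨⟨i, l⟩, hl⟩

/-- The permutation `σ_π = (i_{1,1}, …, i_{1,j₁}, …, i_{k,1}, …, i_{k,jₖ})` listing the elements of
the blocks, the blocks being ordered by their minimal elements and each of them increasingly. -/
noncomputable def perm : Fin (∑ i, π.size i) ≃ Fin n :=
  finSigmaFinEquiv.symm.trans (Equiv.ofBijective π.elem π.elem_bijective)

/-- The partition `{{i} | i ∉ J} ∪ {J}`. -/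
def ofSubset (J : Finset (Fin n)) (hJ : J.Nonempty) : SetPart n :=
  (⊥ : Finpartition Jᶜ).extend hJ.ne_empty disjoint_compl_left
    (by rw [Finset.sup_eq_union, Finset.union_comm, Finset.union_compl])

end SetPart

/-! ### The group product and the pre-Lie product -/

namespace SymmetricOperad

variable {k : Type*} [CommRing k] {P : ℕ → Type*} [∀ n, AddCommGroup (P n)]
  [∀ n, Module k (P n)] (O : SymmetricOperad k P)

/-- The sequence with components `u` in `P 1` and `f i` in `P (i + 2)` (and zero in `P 0`). -/
def toSeq (u : P 1) (f : ∀ i : ℕ, P (i + 2)) : ∀ n, P n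
  | 0 => 0
  | 1 => u
  | i + 2 => f i

/-- `∏_{n ≥ 2} P(n)` as the set `{id} × ∏_{n ≥ 2} P(n)`. -/
def groupSeq (f : ∀ i : ℕ, P (i + 2)) : ∀ n, P n := toSeq O.one f

/-- `∏_{n ≥ 2} P(n)` as the space `{0} × ∏_{n ≥ 2} P(n)`. -/
def lieSeq (f : ∀ i : ℕ, P (i + 2)) : ∀ n, P n := toSeq 0 f

/-- The sequence `(id, 0, 0, …)`. -/
def unitSeq : ∀ n, P n := O.groupSeq 0

/-- The summand `γ(gₖ; f_{j₁}, …, f_{jₖ})^{σ_π}` belonging to a partition `π`. -/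
noncomputable def partTerm {n : ℕ} (π : SetPart n) (g f : ∀ n, P n) : P n :=
  O.map π.perm (O.comp π.size (g π.numBlocks) (fun i => f (π.size i)))

/-- The product `(g • f)ₙ = ∑_π γ(gₖ; f_{j₁}, …, f_{jₖ})^{σ_π}`. -/
noncomputable def bullet (g f : ∀ n, P n) (n : ℕ) : P n := ∑ π : SetPart n, O.partTerm π g f

/-- The product `(f * g)ₙ = ∑_J γ(gₖ; id, …, id, f_j, id, …, id)^{σ_{π_J}}` over the nonempty
subsets `J` of `{1, …, n}`, with `j = |J|` and `f_j` at position `min J`. -/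
noncomputable def star (f g : ∀ n, P n) (n : ℕ) : P n :=
  ∑ J : {J : Finset (Fin n) // J.Nonempty},
    O.map (SetPart.ofSubset J.1 J.2).perm
      (O.comp (SetPart.ofSubset J.1 J.2).size (g (SetPart.ofSubset J.1 J.2).numBlocks)
        (fun i => if (i : ℕ) = (J.1.min' J.2 : ℕ) then f _ else O.unitSeq _))

/-- The pre-Lie product on `L(P) = {0} × ∏_{n ≥ 2} P(n)`. -/
noncomputable def preLie (f g : ∀ i : ℕ, P (i + 2)) : ∀ i : ℕ, P (i + 2) :=
  fun i => O.star (lieSeq f) (lieSeq g) (i + 2)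

/-- The bracket `[f, g] = f * g - g * f` on `L(P)`. -/
noncomputable def bracket (f g : ∀ i : ℕ, P (i + 2)) : ∀ i : ℕ, P (i + 2) :=
  O.preLie f g - O.preLie g f

end SymmetricOperad

/-- The space `∏_{n ≥ 2} P(n)`, underlying both `H(P)` and `L(P)`. -/
abbrev OperadSeries (P : ℕ → Type*) : Type _ := ∀ i : ℕ, P (i + 2)

/-- The space `∏_{n = 2}^{r + 1} P(n)`, underlying the quotients of `H(P)` and `L(P)` by the
series whose components in `P(2), …, P(r + 1)` vanish. -/
abbrev TruncSeries (P : ℕ → Type*) (r : ℕ) : Type _ := ∀ i : Fin r, P (i + 2)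

/-- The projection `∏_{n ≥ 2} P(n) → ∏_{n = 2}^{r + 1} P(n)`. -/
def truncate {P : ℕ → Type*} (r : ℕ) (f : OperadSeries P) : TruncSeries P r := fun i => f i

/-- The projection `∏_{n = 2}^{r + 2} P(n) → ∏_{n = 2}^{r + 1} P(n)`. -/
def truncateSucc {P : ℕ → Type*} (r : ℕ) (f : TruncSeries P (r + 1)) : TruncSeries P r :=
  fun i => f i.castSucc

/-! ### Lie algebras of Lie groups and of their inverse limits -/

section LieGroups

variable {𝕜 : Type*} [NontriviallyNormedField 𝕜]
  {H : Type*} [TopologicalSpace H] {E : Type*} [NormedAddCommGroup E] [NormedSpace 𝕜 E]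
  {I : ModelWithCorners 𝕜 E H}
  {G : Type*} [TopologicalSpace G] [ChartedSpace H G] [Group G]

/-- The right-invariant vector field with value `v` at the identity. -/
noncomputable def rightInvariantVectorField (v : GroupLieAlgebra I G) (g : G) :
    TangentSpace I g :=
  mfderiv I I (fun x => x * g) (1 : G) v

/-- The bracket of right-invariant vector fields, on the tangent space at the identity. (Mathlib's
`⁅v, w⁆` on `GroupLieAlgebra I G` is the bracket of left-invariant vector fields.) -/
noncomputable def rightInvariantBracket (v w : GroupLieAlgebra I G) : GroupLieAlgebra I G :=
  VectorField.mlieBracket I (rightInvariantVectorField v) (rightInvariantVectorField w) (1 : G)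

/-- The space underlying the Lie algebra of the inverse limit of a sequence of Lie groups `G r`
with transition maps `φ r : G (r + 1) → G r`: the inverse limit of the tangent spaces at the
identities, along the differentials of the transition maps. Its bracket is componentwise. -/
def limitLieAlgebra {E : ℕ → Type*} [∀ r, NormedAddCommGroup (E r)] [∀ r, NormedSpace 𝕜 (E r)]
    (G : ℕ → Type*) [∀ r, TopologicalSpace (G r)] [∀ r, ChartedSpace (E r) (G r)]
    [∀ r, Group (G r)] (φ : ∀ r, G (r + 1) →* G r) :
    Submodule 𝕜 (∀ r, GroupLieAlgebra 𝓘(𝕜, E r) (G r)) where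
  carrier := {v | ∀ r, mfderiv 𝓘(𝕜, E (r + 1)) 𝓘(𝕜, E r) (φ r) 1 (v (r + 1)) =
    (show TangentSpace 𝓘(𝕜, E r) (φ r 1) from v r)}
  zero_mem' := by
    intro r
    exact map_zero _
  add_mem' := by
    intro v w hv hw r
    have h := map_add (mfderiv 𝓘(𝕜, E (r + 1)) 𝓘(𝕜, E r) (φ r) 1) (v (r + 1)) (w (r + 1))
    rw [hv r, hw r] at h
    exact h
  smul_mem' := by
    intro c v hv r
    have h := map_smul (mfderiv 𝓘(𝕜, E (r + 1)) 𝓘(𝕜, E r) (φ r) 1) c (v (r + 1))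
    rw [hv r] at h
    exact h

end LieGroups

/-! ### Lexicographic order on `Fin` sigma types -/

/-! A partition with ordered blocks is the same as a surjection `p : Fin n → Fin k` in which new
values appear in increasing order (`Shuffle`). For an arbitrary map `p`, `term p μ ν` composes with
inputs labelled by the fibres of `p`. The associativity and both equivariance axioms of the operad
combine into one law, `term_term`: composing along `p` after `q` is composing along `q ∘ p`, with
compositions along the induced maps of fibres inside.

Associativity of `•` is then combinatorial. A partition together with a partition of its set of
blocks amounts to a coarse partition together with a partition of each of its blocks
(`split_bijective`). Inverses exist because `(g • f) n` is `g n` plus terms involving only `g k`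
with `k < n` (`bullet_eq_add_sum`).

The product `•` is linear in its left factor. Let `linBullet g f` be the part of `g • (id + f)`
linear in `f`. On `L(P)` it equals `f * g`, since `f` vanishes in arity 1 and the unit vanishes
elsewhere, so only partitions with exactly one non-singleton block survive. Expanding `linBullet
(linBullet h g) f`, either `f` is inserted into `g`, which gives `linBullet h (linBullet g f)`, or
`f` and `g` occupy different blocks of `h` (`linBullet_linBullet`). The second part is symmetric in
`f` and `g`; this is the pre-Lie identity.

Arity `n` of a product or an inverse depends only on arities up to `n`, so the group structure
descends to truncations, where the operations are polynomial, hence analytic. The right-invariant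
field of `w` is `g ↦ w • g`, with derivative `v * w` at the unit in the direction `v`;
antisymmetrising gives `[v, w]`. The left-invariant field is `g ↦ linBullet g w`, with derivative `w
* v`, whence the opposite sign. Truncations are linear in the coordinates, so the limit of the
tangent spaces is `L(P)`. -/

theorem Sigma.fin_ext {ι : Type*} {n : ι → ℕ} {x y : Σ i, Fin (n i)} (h : x.1 = y.1)
    (h' : (x.2 : ℕ) = y.2) : x = y := by
  obtain ⟨i, a⟩ := x
  obtain ⟨j, b⟩ := y
  dsimp only at h
  subst h
  exact congrArg _ (Fin.ext h')

theorem finSigmaFinEquiv_val {m : ℕ} {n : Fin m → ℕ} (x : Σ i, Fin (n i)) :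
    (finSigmaFinEquiv x : ℕ) = ∑ i ∈ Finset.Iio x.1, n i + x.2 := by
  rw [finSigmaFinEquiv_apply]
  congr 1
  refine Finset.sum_bij (fun i _ => Fin.castLE x.1.2.le i) ?_ ?_ ?_ ?_
  · intro i _
    exact Finset.mem_Iio.2 (Fin.lt_def.2 i.2)
  · intro i _ j _ h
    exact Fin.castLE_injective _ h
  · intro b hb
    exact ⟨⟨b, Fin.lt_def.1 (Finset.mem_Iio.1 hb)⟩, Finset.mem_univ _, rfl⟩
  · intro i _
    rfl

theorem finSigmaFinEquiv_lt_of_fst_lt {m : ℕ} {n : Fin m → ℕ} {x y : Σ i, Fin (n i)}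
    (h : x.1 < y.1) : finSigmaFinEquiv x < finSigmaFinEquiv y := by
  rw [Fin.lt_def, finSigmaFinEquiv_val, finSigmaFinEquiv_val]
  have h1 : ∑ i ∈ insert x.1 (Finset.Iio x.1), n i ≤ ∑ i ∈ Finset.Iio y.1, n i := by
    refine Finset.sum_le_sum_of_subset fun i hi => ?_
    rcases Finset.mem_insert.1 hi with rfl | hi
    · exact Finset.mem_Iio.2 h
    · exact Finset.mem_Iio.2 ((Finset.mem_Iio.1 hi).trans h)
  rw [Finset.sum_insert (by simp)] at h1
  have := x.2.2
  omega

theorem finSigmaFinEquiv_mk_lt_mk_iff {m : ℕ} {n : Fin m → ℕ} {i : Fin m} {a b : Fin (n i)} :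
    finSigmaFinEquiv ⟨i, a⟩ < finSigmaFinEquiv ⟨i, b⟩ ↔ a < b := by
  rw [Fin.lt_def, finSigmaFinEquiv_val, finSigmaFinEquiv_val, Fin.lt_def]
  simp

theorem finSigmaFinEquiv_lt_iff {m : ℕ} {n : Fin m → ℕ} {x y : Σ i, Fin (n i)} :
    finSigmaFinEquiv x < finSigmaFinEquiv y ↔
      x.1 < y.1 ∨ ∃ _ : x.1 = y.1, (x.2 : ℕ) < y.2 := by
  obtain ⟨i, a⟩ := x
  obtain ⟨j, b⟩ := y
  rcases lt_trichotomy i j with h | rfl | h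
  · simp [finSigmaFinEquiv_lt_of_fst_lt (x := ⟨i, a⟩) (y := ⟨j, b⟩) h, h]
  · simp [finSigmaFinEquiv_mk_lt_mk_iff]
  · have := finSigmaFinEquiv_lt_of_fst_lt (x := ⟨j, b⟩) (y := ⟨i, a⟩) h
    simp [this.not_gt, h.not_gt, h.ne']

theorem Fin.val_equiv_of_strictMono {m n : ℕ} (e : Fin m ≃ Fin n) (he : StrictMono e) (x : Fin m) :
    (e x : ℕ) = x :=
  Fin.coe_orderIso_apply ((he.orderIsoOfSurjective e e.surjective)) x

/-- Both numberings are the lexicographic order on triples `(i, l, t)`. The reassociation `e` is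
therefore an increasing bijection of standard finite sets, and such a bijection preserves values. -/
theorem finSigmaFinEquiv_assoc {m : ℕ} (j : Fin m → ℕ) (r : Fin (∑ i, j i) → ℕ) (i : Fin m)
    (l : Fin (j i)) (t : Fin (r (finSigmaFinEquiv ⟨i, l⟩))) :
    (finSigmaFinEquiv (n := r) ⟨finSigmaFinEquiv ⟨i, l⟩, t⟩ : ℕ) =
      finSigmaFinEquiv (n := fun i => ∑ l, r (finSigmaFinEquiv ⟨i, l⟩))
        ⟨i, finSigmaFinEquiv (n := fun l => r (finSigmaFinEquiv ⟨i, l⟩)) ⟨l, t⟩⟩ := by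
  let e : Fin (∑ x, r x) ≃ Fin (∑ i, ∑ l, r (finSigmaFinEquiv ⟨i, l⟩)) :=
    finSigmaFinEquiv.symm.trans <|
      (Equiv.sigmaCongrLeft (β := fun x => Fin (r x)) finSigmaFinEquiv).symm.trans <|
      (Equiv.sigmaAssoc (fun i l => Fin (r (finSigmaFinEquiv ⟨i, l⟩)))).trans <|
      (Equiv.sigmaCongrRight fun i => finSigmaFinEquiv).trans finSigmaFinEquiv
  have he : ∀ (i : Fin m) (l : Fin (j i)) (t : Fin (r (finSigmaFinEquiv ⟨i, l⟩))),
      e (finSigmaFinEquiv (n := r) ⟨finSigmaFinEquiv ⟨i, l⟩, t⟩) =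
      finSigmaFinEquiv (n := fun i => ∑ l, r (finSigmaFinEquiv ⟨i, l⟩))
        ⟨i, finSigmaFinEquiv (n := fun l => r (finSigmaFinEquiv ⟨i, l⟩)) ⟨l, t⟩⟩ := by
    intro i l t
    have : (Equiv.sigmaCongrLeft (β := fun x => Fin (r x)) finSigmaFinEquiv).symm
        ⟨finSigmaFinEquiv ⟨i, l⟩, t⟩ = ⟨⟨i, l⟩, t⟩ := by
      rw [Equiv.symm_apply_eq]; rfl
    simp only [e, Equiv.trans_apply, Equiv.symm_apply_apply, this]
    rfl
  rw [← he]
  refine (Fin.val_equiv_of_strictMono e ?_ _).symm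
  intro x y hxy
  obtain ⟨⟨x, t⟩, rfl⟩ := finSigmaFinEquiv.surjective x
  obtain ⟨⟨y, t'⟩, rfl⟩ := finSigmaFinEquiv.surjective y
  obtain ⟨⟨i, l⟩, rfl⟩ := finSigmaFinEquiv.surjective x
  obtain ⟨⟨i', l'⟩, rfl⟩ := finSigmaFinEquiv.surjective y
  rw [he, he]
  rw [finSigmaFinEquiv_lt_iff] at hxy
  rcases hxy with h | ⟨h, h'⟩
  · dsimp only at h
    rw [finSigmaFinEquiv_lt_iff] at h
    rcases h with h | ⟨h, h'⟩
    · exact finSigmaFinEquiv_lt_of_fst_lt h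
    · dsimp only at h
      subst h
      rw [finSigmaFinEquiv_mk_lt_mk_iff]
      exact finSigmaFinEquiv_lt_of_fst_lt h'
  · have h2 := finSigmaFinEquiv.injective h
    simp only [Sigma.mk.injEq] at h2
    obtain ⟨rfl, h2⟩ := h2
    obtain rfl := eq_of_heq h2
    rw [finSigmaFinEquiv_mk_lt_mk_iff, finSigmaFinEquiv_mk_lt_mk_iff]
    exact h'

/-! ### Fibres of maps between standard finite sets -/

section Fibers

variable {n k m : ℕ}

/-- The fibre of `p` over `i`. -/
def fiber (p : Fin n → Fin k) (i : Fin k) : Finset (Fin n) := Finset.univ.filter fun a => p a = i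

@[simp] theorem mem_fiber {p : Fin n → Fin k} {i : Fin k} {a : Fin n} : a ∈ fiber p i ↔ p a = i := by
  simp [fiber]

/-- The cardinality of the fibre of `p` over `i`. -/
def fiberSize (p : Fin n → Fin k) (i : Fin k) : ℕ := (fiber p i).card

/-- The `l`-th element of the fibre of `p` over `i`. -/
def fiberElem (p : Fin n → Fin k) (x : Σ i, Fin (fiberSize p i)) : Fin n :=
  (fiber p x.1).orderEmbOfFin rfl x.2

theorem apply_fiberElem (p : Fin n → Fin k) (x : Σ i, Fin (fiberSize p i)) :
    p (fiberElem p x) = x.1 :=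
  mem_fiber.1 (Finset.orderEmbOfFin_mem _ _ _)

theorem fiberElem_strictMono (p : Fin n → Fin k) (i : Fin k) :
    StrictMono fun l => fiberElem p ⟨i, l⟩ :=
  ((fiber p i).orderEmbOfFin rfl).strictMono

theorem exists_fiberElem_eq {p : Fin n → Fin k} {i : Fin k} {a : Fin n} (h : p a = i) :
    ∃ l, fiberElem p ⟨i, l⟩ = a := by
  have : a ∈ Set.range ((fiber p i).orderEmbOfFin rfl) := by
    rw [Finset.range_orderEmbOfFin]; exact mem_fiber.2 h
  exact this

theorem fiberElem_bijective (p : Fin n → Fin k) : Function.Bijective (fiberElem p) := by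
  constructor
  · rintro ⟨i, l⟩ ⟨i', l'⟩ h
    have h1 := congrArg p h
    rw [apply_fiberElem p, apply_fiberElem p] at h1
    dsimp only at h1
    subst h1
    rw [(fiberElem_strictMono p i).injective h]
  · intro a
    obtain ⟨l, hl⟩ := exists_fiberElem_eq (p := p) (a := a) rfl
    exact ⟨_, hl⟩

/-- The decomposition of `Fin n` into the fibres of `p`. -/
noncomputable def fiberEquiv (p : Fin n → Fin k) : (Σ i, Fin (fiberSize p i)) ≃ Fin n :=
  Equiv.ofBijective _ (fiberElem_bijective p)

/-- The permutation listing the elements of the fibres of `p`. -/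
noncomputable def fiberPerm (p : Fin n → Fin k) : Fin (∑ i, fiberSize p i) ≃ Fin n :=
  finSigmaFinEquiv.symm.trans (fiberEquiv p)

theorem fiberPerm_finSigmaFinEquiv (p : Fin n → Fin k) (x : Σ i, Fin (fiberSize p i)) :
    fiberPerm p (finSigmaFinEquiv x) = fiberElem p x := by
  simp [fiberPerm, fiberEquiv]

/-- A finite set has only one increasing enumeration. Later identifications of input labellings rest
on this. -/
theorem fiberElem_eq_of_strictMono (p : Fin n → Fin k) (i : Fin k) {N : ℕ} (h : fiberSize p i = N)
    (f : Fin N → Fin n) (hf : ∀ t, p (f t) = i) (hmono : StrictMono f) (t : Fin N) :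
    f t = fiberElem p ⟨i, t.cast h.symm⟩ := by
  subst h
  rw [Finset.orderEmbOfFin_unique (s := fiber p i) rfl (fun t => mem_fiber.2 (hf t)) hmono]
  rfl

/-- The map induced by `p` from the fibre of `q ∘ p` over `i` to the fibre of `q` over `i`. -/
def fiberMap (p : Fin n → Fin k) (q : Fin k → Fin m) (i : Fin m)
    (l : Fin (fiberSize (q ∘ p) i)) : Fin (fiberSize q i) :=
  ((fiber q i).orderIsoOfFin rfl).symm
    ⟨p (fiberElem (q ∘ p) ⟨i, l⟩), mem_fiber.2 (apply_fiberElem (q ∘ p) ⟨i, l⟩)⟩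

theorem fiberElem_fiberMap (p : Fin n → Fin k) (q : Fin k → Fin m) (i : Fin m)
    (l : Fin (fiberSize (q ∘ p) i)) :
    fiberElem q ⟨i, fiberMap p q i l⟩ = p (fiberElem (q ∘ p) ⟨i, l⟩) := by
  unfold fiberElem fiberMap
  rw [← Finset.coe_orderIsoOfFin_apply]
  simp
  rfl

theorem fiberMap_eq_iff {p : Fin n → Fin k} {q : Fin k → Fin m} {i : Fin m}
    {a : Fin (fiberSize (q ∘ p) i)} {l : Fin (fiberSize q i)} :
    fiberMap p q i a = l ↔ p (fiberElem (q ∘ p) ⟨i, a⟩) = fiberElem q ⟨i, l⟩ := by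
  rw [← fiberElem_fiberMap p q, (fiberElem_strictMono q i).injective.eq_iff]

theorem fiberSize_fiberMap (p : Fin n → Fin k) (q : Fin k → Fin m) (i : Fin m)
    (l : Fin (fiberSize q i)) :
    fiberSize p (fiberElem q ⟨i, l⟩) = fiberSize (fiberMap p q i) l := by
  symm
  refine Finset.card_bij (fun a _ => fiberElem (q ∘ p) ⟨i, a⟩) ?_ ?_ ?_
  · intro a ha
    rw [mem_fiber] at ha ⊢
    exact fiberMap_eq_iff.1 ha
  · intro a _ b _ h
    exact (fiberElem_strictMono _ i).injective h
  · intro b hb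
    rw [mem_fiber] at hb
    obtain ⟨a, rfl⟩ := exists_fiberElem_eq (p := q ∘ p) (i := i) (a := b)
      (by rw [Function.comp_apply, hb, apply_fiberElem q])
    exact ⟨a, mem_fiber.2 (fiberMap_eq_iff.2 hb), rfl⟩

/-- The nested enumeration is increasing and stays in one fibre of `p`, so it is the enumeration of
that fibre. -/
theorem fiberElem_fiberElem (p : Fin n → Fin k) (q : Fin k → Fin m) (i : Fin m)
    (l : Fin (fiberSize q i)) (t : Fin (fiberSize (fiberMap p q i) l)) :
    fiberElem (q ∘ p) ⟨i, fiberElem (fiberMap p q i) ⟨l, t⟩⟩ =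
      fiberElem p ⟨fiberElem q ⟨i, l⟩, t.cast (fiberSize_fiberMap p q i l).symm⟩ := by
  refine fiberElem_eq_of_strictMono p _ (fiberSize_fiberMap p q i l)
    (fun t => fiberElem (q ∘ p) ⟨i, fiberElem (fiberMap p q i) ⟨l, t⟩⟩) ?_ ?_ t
  · intro t
    exact fiberMap_eq_iff.1 (apply_fiberElem _ _)
  · exact (fiberElem_strictMono _ i).comp (fiberElem_strictMono _ l)

end Fibers

/-! ### Operadic composition along a map -/

namespace SymmetricOperad

variable {R : Type*} [CommRing R] {P : ℕ → Type*} [∀ n, AddCommGroup (P n)]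
  [∀ n, Module R (P n)] (O : SymmetricOperad R P)

theorem map_finCongr_self {n : ℕ} (h : n = n) (μ : P n) : O.map (finCongr h) μ = μ := by
  rw [finCongr_refl, O.map_refl]

theorem map_finCongr_seq {m n : ℕ} (h : m = n) (f : ∀ n, P n) : O.map (finCongr h) (f m) = f n := by
  subst h
  exact O.map_finCongr_self _ _

theorem map_finCongr_family {ι : Type*} (r : ι → ℕ) (f : ∀ x, P (r x)) {x y : ι} (h : x = y) {n : ℕ}
    (hx : r x = n) (hy : r y = n) : O.map (finCongr hx) (f x) = O.map (finCongr hy) (f y) := by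
  subst h
  rfl

/-- The composition `γ(μ; ν₁, …, νₖ)` with the inputs of `νᵢ` labelled, in order, by the elements
of the fibre of `p` over `i`. -/
noncomputable def term {n k : ℕ} (p : Fin n → Fin k) :
    P k →ₗ[R] MultilinearMap R (fun i => P (fiberSize p i)) (P n) where
  toFun μ := (O.map (fiberPerm p)).compMultilinearMap (O.comp (fiberSize p) μ)
  map_add' μ μ' := by ext; simp
  map_smul' c μ := by ext; simp

theorem term_apply {n k : ℕ} (p : Fin n → Fin k) (μ : P k) (ν : ∀ i, P (fiberSize p i)) :
    O.term p μ ν = O.map (fiberPerm p) (O.comp (fiberSize p) μ ν) := rfl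

/-- Equivariance moves all renamings to the outside, `comp_assoc` identifies the remaining
compositions, and the two resulting relabellings agree by `fiberElem_fiberElem`. This is the only
use of `comp_assoc`. -/
theorem term_term {n k m : ℕ} (p : Fin n → Fin k) (q : Fin k → Fin m) (h : P m)
    (g : ∀ i, P (fiberSize q i)) (f : ∀ x, P (fiberSize p x)) :
    O.term p (O.term q h g) f =
      O.term (q ∘ p) h fun i => O.term (fiberMap p q i) (g i) fun l =>
        O.map (finCongr (fiberSize_fiberMap p q i l)) (f (fiberElem q ⟨i, l⟩)) := by
  simp only [term_apply]
  rw [O.map_comp, ← O.map_trans]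
  have key : ∀ (i : Fin m) (l : Fin (fiberSize q i)),
      fiberSize p (fiberPerm q (finSigmaFinEquiv ⟨i, l⟩)) = fiberSize (fiberMap p q i) l := by
    intro i l
    rw [fiberPerm_finSigmaFinEquiv, fiberSize_fiberMap]
  have hf : ∀ (i : Fin m) (l : Fin (fiberSize q i)),
      O.map (finCongr (fiberSize_fiberMap p q i l)) (f (fiberElem q ⟨i, l⟩)) =
        O.map (finCongr (key i l)) (f (fiberPerm q (finSigmaFinEquiv ⟨i, l⟩))) := fun i l =>
    O.map_finCongr_family _ f (fiberPerm_finSigmaFinEquiv q ⟨i, l⟩).symm _ _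
  simp only [hf]
  have hin : ∀ i : Fin m, O.map (fiberPerm (fiberMap p q i)) (O.comp (fiberSize (fiberMap p q i))
      (g i) fun l => O.map (finCongr (key i l)) (f (fiberPerm q (finSigmaFinEquiv ⟨i, l⟩)))) =
      O.map ((finSigmaFinEquiv.symm.trans ((Equiv.sigmaCongrRight fun l => finCongr (key i l)).trans
        finSigmaFinEquiv)).trans (fiberPerm (fiberMap p q i)))
        (O.comp _ (g i) fun l => f (fiberPerm q (finSigmaFinEquiv ⟨i, l⟩))) := by
    intro i
    rw [O.comp_map, ← O.map_trans]
  simp only [hin]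
  rw [O.comp_map, ← O.comp_assoc (fiberSize q) (fun x => fiberSize p (fiberPerm q x)) h g
    (fun x => f (fiberPerm q x)), ← O.map_trans, ← O.map_trans]
  congr 2
  ext y
  obtain ⟨⟨x, t⟩, rfl⟩ := finSigmaFinEquiv.surjective y
  obtain ⟨⟨i, l⟩, rfl⟩ := finSigmaFinEquiv.surjective x
  congr 1
  have e1 : (finCongr (sum_sum_finSigma (fiberSize q) fun x => fiberSize p (fiberPerm q x)))
      (finSigmaFinEquiv ⟨finSigmaFinEquiv ⟨i, l⟩, t⟩) =
      finSigmaFinEquiv ⟨i, finSigmaFinEquiv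
        (n := fun l => fiberSize p (fiberPerm q (finSigmaFinEquiv ⟨i, l⟩))) ⟨l, t⟩⟩ :=
    Fin.ext (finSigmaFinEquiv_assoc (fiberSize q) (fun x => fiberSize p (fiberPerm q x)) i l t)
  simp only [Equiv.trans_apply, e1, Equiv.symm_apply_apply, Equiv.sigmaCongrRight_apply,
    fiberPerm_finSigmaFinEquiv]
  rw [fiberElem_fiberElem]
  exact congrArg _ (Sigma.fin_ext (fiberPerm_finSigmaFinEquiv q ⟨i, l⟩) rfl)

end SymmetricOperad

/-! ### Restricted growth functions -/

/-- A partition of `Fin n` with blocks ordered by their minimal elements, given as the map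
sending an element to the index of its block. -/
structure Shuffle (n : ℕ) where
  /-- the number of blocks -/
  k : ℕ
  /-- the index of the block of an element -/
  p : Fin n → Fin k
  surj : Function.Surjective p
  exists_lt : ∀ a, ∀ i < p a, ∃ b < a, p b = i

namespace Shuffle

variable {n : ℕ}

/-- Growth forces every index below that of `a` to occur before `a`. If the earlier indices agree
and `t.p a < s.p a`, then `s` takes the value `t.p a` at some earlier `b`; there `t` takes it too,
so `a` and `b` share a block, a contradiction. -/
theorem val_eq_of_ker {s t : Shuffle n} (h : ∀ a b, s.p a = s.p b ↔ t.p a = t.p b) (a : Fin n) :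
    (s.p a : ℕ) = t.p a := by
  have aux : ∀ {s t : Shuffle n}, (∀ a b, s.p a = s.p b ↔ t.p a = t.p b) → ∀ a : Fin n,
      (∀ b < a, (s.p b : ℕ) = t.p b) → (s.p a : ℕ) ≤ t.p a := by
    intro s t h a ih
    by_contra! hlt
    obtain ⟨b, hb, hb'⟩ := s.exists_lt a ⟨t.p a, hlt.trans (s.p a).2⟩ hlt
    have h1 : t.p b = t.p a := Fin.ext (by rw [← ih b hb, hb'])
    have h2 := (h b a).2 h1
    rw [← h2, hb'] at hlt
    exact lt_irrefl _ hlt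
  induction a using WellFoundedLT.induction with
  | ind a ih =>
    exact le_antisymm (aux h a ih) (aux (fun a b => (h a b).symm) a fun b hb => (ih b hb).symm)

theorem ext_of_ker {s t : Shuffle n} (h : ∀ a b, s.p a = s.p b ↔ t.p a = t.p b) : s = t := by
  have hv := val_eq_of_ker h
  have hk : s.k = t.k := by
    refine le_antisymm ?_ ?_
    · by_contra! hlt
      obtain ⟨a, ha⟩ := s.surj ⟨t.k, hlt⟩
      have := hv a
      rw [ha] at this
      exact absurd (t.p a).2 (by simp [← this])
    · by_contra! hlt
      obtain ⟨a, ha⟩ := t.surj ⟨s.k, hlt⟩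
      have := hv a
      rw [ha] at this
      exact absurd (s.p a).2 (by simp [this])
  obtain ⟨k, p, _, _⟩ := s
  obtain ⟨k', p', _, _⟩ := t
  dsimp only at hk
  subst hk
  have : p = p' := funext fun a => Fin.ext (hv a)
  subst this
  rfl

theorem k_le (s : Shuffle n) : s.k ≤ n := by
  simpa using Fintype.card_le_of_surjective _ s.surj

theorem fiberSize_pos (s : Shuffle n) (i : Fin s.k) : 0 < fiberSize s.p i := by
  obtain ⟨a, ha⟩ := s.surj i
  exact Finset.card_pos.2 ⟨a, mem_fiber.2 ha⟩

theorem _root_.fiberSize_le {k : ℕ} (p : Fin n → Fin k) (i : Fin k) : fiberSize p i ≤ n := by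
  simpa [fiberSize] using Finset.card_le_univ (fiber p i)

/-- The partition into singletons. -/
def discrete (n : ℕ) : Shuffle n := ⟨n, id, Function.surjective_id, fun _ i hi => ⟨i, hi, rfl⟩⟩

theorem eq_discrete {s : Shuffle n} (h : n ≤ s.k) : s = discrete n := by
  have hk := s.k_le
  have hinj : Function.Injective s.p :=
    ((Fintype.bijective_iff_surjective_and_card _).2 ⟨s.surj, by simp; omega⟩).1
  exact ext_of_ker fun a b => hinj.eq_iff

/-- The partition with one block. -/
def indiscrete (n : ℕ) (hn : 0 < n) : Shuffle n :=
  ⟨1, fun _ => 0, fun i => ⟨⟨0, hn⟩, Subsingleton.elim _ _⟩, fun _ i hi => by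
    rw [Subsingleton.elim i 0] at hi; exact absurd hi (lt_irrefl _)⟩

theorem eq_indiscrete {s : Shuffle n} (hn : 0 < n) (h : s.k = 1) : s = indiscrete n hn :=
  ext_of_ker fun a b => by
    have := (s.p a).2
    have := (s.p b).2
    exact ⟨fun _ => rfl, fun _ => Fin.ext (by omega)⟩

end Shuffle

/-! ### Set partitions as restricted growth functions -/

namespace SetPart

variable {n : ℕ} (π : SetPart n)

/-- The index of the block of an element. -/
noncomputable def index (a : Fin n) : Fin π.numBlocks :=
  ((Equiv.ofBijective π.elem π.elem_bijective).symm a).1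

theorem index_elem (x : Σ i : Fin π.numBlocks, Fin (π.size i)) : π.index (π.elem x) = x.1 := by
  unfold index
  rw [show π.elem x = Equiv.ofBijective π.elem π.elem_bijective x from rfl, Equiv.symm_apply_apply]

theorem elem_mem_block (x : Σ i : Fin π.numBlocks, Fin (π.size i)) : π.elem x ∈ π.block x.1 :=
  Finset.orderEmbOfFin_mem _ _ _

theorem block_mem_parts (i : Fin π.numBlocks) : π.block i ∈ π.parts :=
  π.part_mem.2 (Finset.mem_univ _)

theorem mem_block_index (a : Fin n) : a ∈ π.block (π.index a) := by
  obtain ⟨x, rfl⟩ := π.elem_bijective.2 a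
  rw [index_elem]
  exact π.elem_mem_block x

theorem index_eq_iff {a : Fin n} {i : Fin π.numBlocks} : π.index a = i ↔ a ∈ π.block i := by
  constructor
  · rintro rfl
    exact π.mem_block_index a
  · intro h
    have : a ∈ Set.range ((π.block i).orderEmbOfFin rfl) := by
      rw [Finset.range_orderEmbOfFin]; exact h
    obtain ⟨l, hl⟩ := this
    rw [← show π.elem ⟨i, l⟩ = a from hl, index_elem]

theorem block_index (a : Fin n) : π.block (π.index a) = π.part a :=
  (π.part_eq_of_mem (π.block_mem_parts _) (π.mem_block_index a)).symm

theorem index_eq_index_iff {a b : Fin n} : π.index a = π.index b ↔ b ∈ π.part a := by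
  rw [eq_comm, index_eq_iff, block_index]

theorem fiber_index (i : Fin π.numBlocks) : fiber π.index i = π.block i := by
  ext a
  rw [mem_fiber, index_eq_iff]

/-- The minimal element of the `i`-th block. -/
def leader (i : Fin π.numBlocks) : Fin n := π.minima.orderEmbOfFin rfl i

theorem leader_strictMono : StrictMono π.leader := (π.minima.orderEmbOfFin rfl).strictMono

theorem leader_mem_block (i : Fin π.numBlocks) : π.leader i ∈ π.block i :=
  π.mem_part (Finset.mem_univ _)

theorem leader_le {i : Fin π.numBlocks} {a : Fin n} (h : a ∈ π.block i) : π.leader i ≤ a :=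
  (Finset.mem_filter.1 (Finset.orderEmbOfFin_mem π.minima rfl i)).2 _ h

/-- The restricted growth function of a partition. -/
noncomputable def toShuffle : Shuffle n where
  k := π.numBlocks
  p := π.index
  surj i := ⟨π.leader i, π.index_eq_iff.2 (π.leader_mem_block i)⟩
  exists_lt a i hi := ⟨π.leader i,
    (π.leader_strictMono hi).trans_le (π.leader_le (π.mem_block_index a)),
    π.index_eq_iff.2 (π.leader_mem_block i)⟩

theorem toShuffle_bijective : Function.Bijective (toShuffle (n := n)) := by
  constructor
  · intro π π' h
    have hp : ∀ a, π.part a = π'.part a := by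
      intro a
      ext b
      rw [← index_eq_index_iff, ← index_eq_index_iff]
      change π.toShuffle.p a = π.toShuffle.p b ↔ π'.toShuffle.p a = π'.toShuffle.p b
      rw [h]
    have hle : ∀ {π π' : SetPart n}, (∀ a, π.part a = π'.part a) → π.parts ⊆ π'.parts := by
      intro π π' hp B hB
      obtain ⟨a, ha⟩ := π.nonempty_of_mem_parts hB
      rw [← π.part_eq_of_mem hB ha, hp]
      exact π'.part_mem.2 (Finset.mem_univ _)
    exact Finpartition.ext (Finset.Subset.antisymm (hle hp) (hle fun a => (hp a).symm))
  · intro s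
    classical
    refine ⟨Finpartition.ofSetoid (Setoid.ker s.p), Shuffle.ext_of_ker fun a b => ?_⟩
    change index _ a = index _ b ↔ _
    rw [index_eq_index_iff, Finpartition.mem_part_ofSetoid_iff_rel]
    rfl

/-- Partitions correspond to restricted growth functions. -/
noncomputable def equivShuffle : SetPart n ≃ Shuffle n := Equiv.ofBijective _ toShuffle_bijective

end SetPart

/-! ### Two-step coarsenings of partitions -/

namespace Shuffle

variable {n : ℕ}

noncomputable instance : Fintype (Shuffle n) := Fintype.ofEquiv _ SetPart.equivShuffle

theorem exists_of_setoid (r : Setoid (Fin n)) : ∃ s : Shuffle n, ∀ a b, s.p a = s.p b ↔ r a b := by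
  classical
  refine ⟨SetPart.toShuffle (Finpartition.ofSetoid r), fun a b => ?_⟩
  change SetPart.index _ a = SetPart.index _ b ↔ _
  rw [SetPart.index_eq_index_iff, Finpartition.mem_part_ofSetoid_iff_rel]

/-- The partition obtained by merging the blocks of `s` according to `t`. -/
def merge (s : Shuffle n) (t : Shuffle s.k) : Shuffle n where
  k := t.k
  p := t.p ∘ s.p
  surj := t.surj.comp s.surj
  exists_lt a i hi := by
    obtain ⟨c, hc, rfl⟩ := t.exists_lt (s.p a) i hi
    obtain ⟨b, hb, rfl⟩ := s.exists_lt a c hc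
    exact ⟨b, hb, rfl⟩

/-- The partition of the `i`-th block of `s.merge t` into blocks of `s`. -/
def restrict (s : Shuffle n) (t : Shuffle s.k) (i : Fin t.k) :
    Shuffle (fiberSize (t.p ∘ s.p) i) where
  k := fiberSize t.p i
  p := fiberMap s.p t.p i
  surj l := by
    obtain ⟨a, ha⟩ := s.surj (fiberElem t.p ⟨i, l⟩)
    obtain ⟨b, rfl⟩ := exists_fiberElem_eq (p := t.p ∘ s.p) (i := i) (a := a)
      (by rw [Function.comp_apply, ha, apply_fiberElem t.p])
    exact ⟨b, fiberMap_eq_iff.2 ha⟩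
  exists_lt a l hl := by
    have h1 := fiberElem_strictMono t.p i hl
    dsimp only at h1
    rw [fiberElem_fiberMap] at h1
    obtain ⟨b, hb, hb'⟩ := s.exists_lt _ _ h1
    obtain ⟨c, rfl⟩ := exists_fiberElem_eq (p := t.p ∘ s.p) (i := i) (a := b)
      (by rw [Function.comp_apply, hb', apply_fiberElem t.p])
    exact ⟨c, (fiberElem_strictMono _ i).lt_iff_lt.1 hb, fiberMap_eq_iff.2 hb'⟩

theorem exists_min_of_block (s : Shuffle n) (i : Fin s.k) :
    ∃ a, s.p a = i ∧ ∀ b, s.p b = i → a ≤ b := by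
  have hne : (fiber s.p i).Nonempty := Finset.card_pos.1 (s.fiberSize_pos i)
  exact ⟨(fiber s.p i).min' hne, mem_fiber.1 (Finset.min'_mem _ _),
    fun b hb => Finset.min'_le _ _ (mem_fiber.2 hb)⟩

/-- Two-step coarsenings correspond to partitions together with partitions of their blocks. -/
def split (x : Σ s : Shuffle n, Shuffle s.k) :
    Σ r : Shuffle n, ∀ i : Fin r.k, Shuffle (fiberSize r.p i) :=
  ⟨x.1.merge x.2, x.1.restrict x.2⟩

theorem restrict_p_eq_iff (s : Shuffle n) (t : Shuffle s.k) {i : Fin t.k}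
    {a b : Fin (fiberSize (t.p ∘ s.p) i)} :
    (s.restrict t i).p a = (s.restrict t i).p b ↔
      s.p (fiberElem (t.p ∘ s.p) ⟨i, a⟩) = s.p (fiberElem (t.p ∘ s.p) ⟨i, b⟩) := by
  change fiberMap _ _ _ _ = fiberMap _ _ _ _ ↔ _
  rw [fiberMap_eq_iff, fiberElem_fiberMap]

/-- The equivalence relation assembled from a partition and partitions of its blocks. -/
theorem ker_iff_of_split_eq {x : Σ s : Shuffle n, Shuffle s.k} {r : Shuffle n}
    {ρ : ∀ i : Fin r.k, Shuffle (fiberSize r.p i)} (h : split x = ⟨r, ρ⟩) (a b : Fin n) :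
    x.1.p a = x.1.p b ↔ ∃ (i : Fin r.k) (c d : Fin (fiberSize r.p i)),
      fiberElem r.p ⟨i, c⟩ = a ∧ fiberElem r.p ⟨i, d⟩ = b ∧ (ρ i).p c = (ρ i).p d := by
  obtain ⟨s, t⟩ := x
  cases h
  constructor
  · intro hab
    dsimp only at hab
    obtain ⟨c, hc⟩ := exists_fiberElem_eq (p := t.p ∘ s.p) (a := a) rfl
    obtain ⟨d, hd⟩ := exists_fiberElem_eq (p := t.p ∘ s.p) (i := (t.p ∘ s.p) a) (a := b)
      (by simp [hab])
    refine ⟨_, c, d, hc, hd, ?_⟩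
    rw [restrict_p_eq_iff, hc, hd, hab]
  · rintro ⟨i, c, d, rfl, rfl, h⟩
    exact (restrict_p_eq_iff s t).1 h

/-- All data are determined by equivalence relations. By `ker_iff_of_split_eq` the image determines
the fine relation, and the coarse one is then its merge. Conversely, the fine relation can be
assembled from `ρ` and the blocks merged according to `r`. -/
theorem split_bijective : Function.Bijective (split (n := n)) := by
  constructor
  · intro x y h
    have h1 : x.1 = y.1 := ext_of_ker fun a b => by
      rw [ker_iff_of_split_eq (x := x) (r := (split y).1) (ρ := (split y).2) h,
        ← ker_iff_of_split_eq (x := y) (r := (split y).1) (ρ := (split y).2) rfl]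
    obtain ⟨s, t⟩ := x
    obtain ⟨s', t'⟩ := y
    dsimp only at h1
    subst h1
    have hm : s.merge t = s.merge t' := congrArg Sigma.fst h
    congr 1
    refine ext_of_ker fun a b => ?_
    obtain ⟨a, rfl⟩ := s.surj a
    obtain ⟨b, rfl⟩ := s.surj b
    change (s.merge t).p a = (s.merge t).p b ↔ (s.merge t').p a = (s.merge t').p b
    rw [hm]
  · rintro ⟨r, ρ⟩
    -- Two elements are finely equivalent when they have the same block in `r` and the same index
    -- inside that block under `ρ`.
    obtain ⟨s, hs⟩ := exists_of_setoid (n := n)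
      (Setoid.ker fun a => (⟨((fiberEquiv r.p).symm a).1, (ρ _).p ((fiberEquiv r.p).symm a).2⟩ :
        Σ i, Fin (ρ i).k))
    have hr : ∀ a, ((fiberEquiv r.p).symm a).1 = r.p a := by
      intro a
      obtain ⟨x, rfl⟩ := (fiberEquiv r.p).surjective a
      rw [Equiv.symm_apply_apply]
      exact (apply_fiberElem r.p x).symm
    have hsr : ∀ a b, s.p a = s.p b → r.p a = r.p b := by
      intro a b hab
      have := congrArg Sigma.fst ((hs a b).1 hab)
      dsimp only at this
      rwa [hr, hr] at this
    let q : Fin s.k → Fin r.k := fun c => r.p (Function.surjInv s.surj c)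
    have hq : ∀ a, q (s.p a) = r.p a := fun a => hsr _ _ (Function.surjInv_eq s.surj (s.p a))
    obtain ⟨t, rfl⟩ : ∃ t : Shuffle s.k, s.merge t = r := by
      refine ⟨⟨r.k, q, fun i => ?_, fun c i hi => ?_⟩, ext_of_ker fun a b => ?_⟩
      · obtain ⟨a, rfl⟩ := r.surj i
        exact ⟨s.p a, hq a⟩
      · obtain ⟨a, ha, hmin⟩ := s.exists_min_of_block c
        rw [← ha, hq] at hi
        obtain ⟨b, hb, rfl⟩ := r.exists_lt a i hi
        refine ⟨s.p b, ?_, hq b⟩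
        -- If `c ≤ s.p b`, block `c` already occurs at or before `b`, contradicting the minimality
        -- of `a > b` in it.
        by_contra! hc
        rcases hc.eq_or_lt with hc | hc
        · exact (hmin b hc.symm).not_gt hb
        · obtain ⟨a', ha', hc'⟩ := s.exists_lt b c hc
          exact (hmin a' hc').not_gt (ha'.trans hb)
      · change q (s.p a) = q (s.p b) ↔ _
        rw [hq, hq]
    have he : ∀ x, (fiberEquiv (s.merge t).p).symm (fiberElem (s.merge t).p x) = x :=
      fun x => (Equiv.symm_apply_eq _).2 rfl
    have hρ : ∀ (i : Fin t.k) (a b : Fin (fiberSize (t.p ∘ s.p) i)),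
        (s.restrict t i).p a = (s.restrict t i).p b ↔ (ρ i).p a = (ρ i).p b := by
      intro i a b
      rw [restrict_p_eq_iff]
      refine (hs _ _).trans ?_
      erw [Setoid.ker_def, he ⟨i, a⟩, he ⟨i, b⟩]
      exact ⟨fun h => eq_of_heq (Sigma.mk.inj h).2, fun h => congrArg (Sigma.mk i) h⟩
    exact ⟨⟨s, t⟩, Sigma.ext rfl (heq_of_eq (funext fun i => ext_of_ker (hρ i)))⟩

end Shuffle

namespace SymmetricOperad

variable {R : Type*} [CommRing R] {P : ℕ → Type*} [∀ n, AddCommGroup (P n)]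
  [∀ n, Module R (P n)] (O : SymmetricOperad R P)

/-! ### The product of sequences as a sum over restricted growth functions -/

theorem term_toShuffle {n : ℕ} (π : SetPart n) (g f : ∀ n, P n) :
    O.term π.toShuffle.p (g π.toShuffle.k) (fun i => f (fiberSize π.toShuffle.p i)) =
      O.partTerm π g f := by
  have hs : ∀ i : Fin π.numBlocks, π.size i = fiberSize π.index i := fun i => by
    rw [fiberSize, π.fiber_index, SetPart.size]
  have hf : (fun i => f (fiberSize π.index i)) =
      fun i => O.map (finCongr (hs i)) (f (π.size i)) :=
    funext fun i => (O.map_finCongr_seq _ f).symm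
  change O.term π.index (g π.numBlocks) (fun i => f (fiberSize π.index i)) = _
  rw [hf, term_apply, O.comp_map, ← O.map_trans, partTerm]
  congr 2
  ext y
  obtain ⟨⟨i, l⟩, rfl⟩ := finSigmaFinEquiv.surjective y
  simp only [Equiv.trans_apply, Equiv.symm_apply_apply, SetPart.perm]
  rw [fiberPerm_finSigmaFinEquiv]
  congr 1
  symm
  exact fiberElem_eq_of_strictMono π.index i (hs i).symm (fun l => π.elem ⟨i, l⟩)
    (fun l => π.index_elem _) ((π.block i).orderEmbOfFin rfl).strictMono l

theorem sum_setPart_eq {n : ℕ} {M : Type*} [AddCommMonoid M] (F : Shuffle n → M) :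
    ∑ π : SetPart n, F π.toShuffle = ∑ s, F s :=
  SetPart.toShuffle_bijective.sum_comp F

theorem bullet_eq_sum (g f : ∀ n, P n) (n : ℕ) :
    O.bullet g f n = ∑ s : Shuffle n, O.term s.p (g s.k) fun i => f (fiberSize s.p i) := by
  rw [← sum_setPart_eq]
  exact Finset.sum_congr rfl fun π _ => (O.term_toShuffle π g f).symm

theorem bullet_congr {g g' f f' : ∀ n, P n} {n : ℕ} (hg : ∀ m ≤ n, g m = g' m)
    (hf : ∀ m ≤ n, f m = f' m) : O.bullet g f n = O.bullet g' f' n := by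
  rw [bullet_eq_sum, bullet_eq_sum]
  refine Finset.sum_congr rfl fun s _ => ?_
  rw [hg _ s.k_le]
  congr 1
  exact funext fun i => hf _ (fiberSize_le _ _)

theorem sum_split {n : ℕ} {M : Type*} [AddCommMonoid M]
    (F : ∀ r : Shuffle n, (∀ i : Fin r.k, Shuffle (fiberSize r.p i)) → M) :
    ∑ s : Shuffle n, ∑ t : Shuffle s.k, F (s.merge t) (s.restrict t) = ∑ r, ∑ ρ, F r ρ := by
  rw [← Fintype.sum_sigma' (fun r ρ => F r ρ), ← Shuffle.split_bijective.sum_comp,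
    ← Fintype.sum_sigma' (fun s t => F (Shuffle.merge s t) (Shuffle.restrict s t))]
  rfl

/-- Multilinearity expands both sides into double sums; `term_term` matches the summands and
`sum_split` the index sets. -/
theorem bullet_assoc (h g f : ∀ n, P n) :
    O.bullet (O.bullet h g) f = O.bullet h (O.bullet g f) := by
  funext n
  simp only [bullet_eq_sum, map_sum, sum_apply, MultilinearMap.map_sum, term_term,
    map_finCongr_seq]
  exact sum_split fun r ρ => O.term r.p (h r.k) fun i =>
    O.term (ρ i).p (g (ρ i).k) fun l => f (fiberSize (ρ i).p l)

/-! ### Units and inverses -/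

@[simp] theorem unitSeq_one : O.unitSeq 1 = O.one := rfl

theorem unitSeq_of_ne_one {n : ℕ} (h : n ≠ 1) : O.unitSeq n = 0 := by
  match n, h with
  | 0, _ => rfl
  | n + 2, _ => rfl

theorem _root_.fiberPerm_comp_sigmaCongrRight {n k : ℕ} {p : Fin n → Fin k} {j : Fin k → ℕ}
    (e : ∀ i, Fin (j i) ≃ Fin (fiberSize p i)) (i : Fin k) (l : Fin (j i)) :
    ((finSigmaFinEquiv.symm.trans ((Equiv.sigmaCongrRight e).trans finSigmaFinEquiv)).trans
      (fiberPerm p)) (finSigmaFinEquiv ⟨i, l⟩) = fiberElem p ⟨i, e i l⟩ := by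
  simp only [Equiv.trans_apply, Equiv.symm_apply_apply]
  rw [fiberPerm_finSigmaFinEquiv]
  rfl

theorem _root_.fiberPerm_comp_eq_finCongr {n k : ℕ} {p : Fin n → Fin k} {j : Fin k → ℕ}
    (e : ∀ i, Fin (j i) ≃ Fin (fiberSize p i)) (hN : ∑ i, j i = n)
    (h : ∀ i l, (fiberElem p ⟨i, e i l⟩ : ℕ) = ∑ x ∈ Finset.Iio i, j x + l) :
    (finSigmaFinEquiv.symm.trans ((Equiv.sigmaCongrRight e).trans finSigmaFinEquiv)).trans
      (fiberPerm p) = finCongr hN := by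
  ext y
  obtain ⟨⟨i, l⟩, rfl⟩ := finSigmaFinEquiv.surjective y
  rw [fiberPerm_comp_sigmaCongrRight, h, finCongr_apply, Fin.val_cast, finSigmaFinEquiv_val]

theorem fiberSize_id (n : ℕ) (i : Fin n) : fiberSize (id : Fin n → Fin n) i = 1 := by
  rw [fiberSize, Finset.card_eq_one]
  exact ⟨i, by ext; simp⟩

theorem term_id {n : ℕ} (μ : P n) {f : ∀ n, P n} (hf : f 1 = O.one) :
    O.term (id : Fin n → Fin n) μ (fun i => f (fiberSize id i)) = μ := by
  have h : (fun i => f (fiberSize (id : Fin n → Fin n) i)) =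
      fun i => O.map (finCongr (fiberSize_id n i).symm) O.one := by
    funext i
    rw [← hf, O.map_finCongr_seq]
  conv_rhs => rw [← O.comp_one μ]
  rw [h, term_apply, O.comp_map, ← O.map_trans]
  congr 1
  refine congrArg O.map (fiberPerm_comp_eq_finCongr _ _ fun i l => ?_)
  refine (congrArg Fin.val (apply_fiberElem (id : Fin n → Fin n) _)).trans ?_
  have := l.2
  simp

theorem term_const {n : ℕ} (f : ∀ n, P n) :
    O.term (fun _ : Fin n => (0 : Fin 1)) O.one (fun i => f (fiberSize _ i)) = f n := by
  have hs : ∀ i, n = fiberSize (fun _ : Fin n => (0 : Fin 1)) i := by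
    intro i
    simp [fiberSize, fiber, Subsingleton.elim i 0]
  have h : (fun i => f (fiberSize (fun _ : Fin n => (0 : Fin 1)) i)) =
      fun i => O.map (finCongr (hs i)) (f n) := by
    funext i
    rw [O.map_finCongr_seq]
  conv_rhs => rw [← O.one_comp (f n)]
  rw [h, term_apply, O.comp_map, ← O.map_trans]
  have hE := fiberPerm_comp_eq_finCongr (p := fun _ : Fin n => (0 : Fin 1)) (j := fun _ => n)
    (fun i => finCongr (hs i)) (by simp) fun i l => by
      have := fiberElem_eq_of_strictMono (fun _ : Fin n => (0 : Fin 1)) i (hs i).symm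
        id (fun _ => Subsingleton.elim _ _) strictMono_id l
      refine (congrArg Fin.val this.symm).trans ?_
      rw [Subsingleton.elim i 0]
      simp
  rw [hE]

/-- Only the partition into singletons has `n` blocks, and it contributes `g n`. This triangular
form in `g` is what the recursion for `leftInv` solves. -/
theorem bullet_eq_add_sum (g : ∀ n, P n) {f : ∀ n, P n} (hf : f 1 = O.one) (n : ℕ) :
    O.bullet g f n = g n + ∑ s : {s : Shuffle n // s.k < n},
      O.term s.1.p (g s.1.k) fun i => f (fiberSize s.1.p i) := by
  rw [bullet_eq_sum, ← Fintype.sum_subtype_add_sum_subtype (fun s : Shuffle n => s.k < n), add_comm]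
  congr 1
  rw [Fintype.sum_eq_single ⟨Shuffle.discrete n, lt_irrefl n⟩]
  · exact O.term_id (g n) hf
  · rintro ⟨s, hs⟩ h
    exact absurd (Subtype.ext (Shuffle.eq_discrete (not_lt.1 hs))) h

theorem term_eq_zero {n : ℕ} (s : Shuffle n) (μ : P s.k) (f : Fin s.k → ∀ n, P n) (i : Fin s.k)
    (hi : f i (fiberSize s.p i) = 0) : O.term s.p μ (fun i => f i (fiberSize s.p i)) = 0 :=
  (O.term s.p μ).map_coord_zero i hi

theorem _root_.Shuffle.exists_fiberSize_ne_one {n : ℕ} {s : Shuffle n} (hs : s.k < n) :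
    ∃ i, fiberSize s.p i ≠ 1 := by
  by_contra! h
  have h1 : ∑ i, fiberSize s.p i = n := by
    simpa using Fintype.card_congr (fiberPerm s.p)
  simp only [h, Finset.sum_const, Finset.card_univ, Fintype.card_fin, smul_eq_mul, mul_one] at h1
  omega

@[simp] theorem bullet_unitSeq (g : ∀ n, P n) : O.bullet g O.unitSeq = g := by
  funext n
  rw [O.bullet_eq_add_sum g O.unitSeq_one, add_eq_left]
  refine Finset.sum_eq_zero fun s _ => ?_
  obtain ⟨i, hi⟩ := Shuffle.exists_fiberSize_ne_one s.2
  exact O.term_eq_zero s.1 _ (fun _ => O.unitSeq) i (O.unitSeq_of_ne_one hi)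

/-- The unit is concentrated in arity 1, so only the one-block partition counts. The abstract `F`
serves both `bullet` and `linBullet`. -/
theorem sum_term_unitSeq (f : ∀ n, P n) (hf : f 0 = 0) {n : ℕ}
    (F : ∀ s : Shuffle n, P s.k → P n) (h0 : ∀ s, F s 0 = 0)
    (h1 : ∀ hn : 0 < n, F (Shuffle.indiscrete n hn) O.one = f n) :
    ∑ s : Shuffle n, F s (O.unitSeq s.k) = f n := by
  -- The empty set has no one-block partition: in arity 0 the sum vanishes, hence the hypothesis `f
  -- 0 = 0`.
  rcases Nat.eq_zero_or_pos n with rfl | hn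
  · rw [hf]
    refine Finset.sum_eq_zero fun s _ => ?_
    rw [O.unitSeq_of_ne_one (by have := s.k_le; omega), h0]
  · rw [Fintype.sum_eq_single (Shuffle.indiscrete n hn)]
    · exact h1 hn
    · intro s hs
      rw [O.unitSeq_of_ne_one fun h => hs (Shuffle.eq_indiscrete hn h), h0]

theorem unitSeq_bullet {f : ∀ n, P n} (hf : f 0 = 0) : O.bullet O.unitSeq f = f := by
  funext n
  rw [bullet_eq_sum]
  exact O.sum_term_unitSeq f hf (fun s μ => O.term s.p μ fun i => f (fiberSize s.p i))
    (fun s => by simp) fun _ => O.term_const f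

/-- The left inverse of a sequence beginning with the identity. -/
noncomputable def leftInv (f : ∀ n, P n) (n : ℕ) : P n :=
  O.unitSeq n - ∑ s : {s : Shuffle n // s.k < n},
    O.term s.1.p (leftInv f s.1.k) fun i => f (fiberSize s.1.p i)
termination_by n
decreasing_by exact s.2

theorem leftInv_bullet {f : ∀ n, P n} (hf : f 1 = O.one) :
    O.bullet (O.leftInv f) f = O.unitSeq := by
  funext n
  rw [O.bullet_eq_add_sum _ hf]
  nth_rewrite 1 [leftInv]
  exact sub_add_cancel _ _

theorem bullet_of_le_one (g : ∀ n, P n) {f : ∀ n, P n} (hf : f 1 = O.one) {n : ℕ} (hn : n ≤ 1) :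
    O.bullet g f n = g n := by
  rw [O.bullet_eq_add_sum g hf, add_eq_left]
  refine Finset.sum_eq_zero fun s _ => ?_
  have h1 := s.2
  have h2 : 0 < s.1.k := Fin.pos (s.1.p ⟨0, by omega⟩)
  omega

theorem leftInv_of_le_one {f : ∀ n, P n} (hf : f 1 = O.one) {n : ℕ} (hn : n ≤ 1) :
    O.leftInv f n = O.unitSeq n := by
  rw [← O.leftInv_bullet hf, O.bullet_of_le_one _ hf hn]

/-! ### The linear part of the product -/

/-- The part of `g • (id + f)` that is linear in `f`. -/
noncomputable def linBullet (g f : ∀ n, P n) (n : ℕ) : P n :=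
  ∑ s : Shuffle n, ∑ x : Fin s.k,
    O.term s.p (g s.k) fun y => (if y = x then f else O.unitSeq) (fiberSize s.p y)

theorem linBullet_unitSeq {f : ∀ n, P n} (hf : f 0 = 0) : O.linBullet O.unitSeq f = f := by
  funext n
  refine O.sum_term_unitSeq f hf (fun s μ => ∑ x : Fin s.k, O.term s.p μ fun y =>
    (if y = x then f else O.unitSeq) (fiberSize s.p y)) (fun s => by simp) fun hn => ?_
  refine (Fintype.sum_subsingleton (ι := Fin 1) _ 0).trans ?_
  refine Eq.trans ?_ (O.term_const f)
  refine congrArg (O.term (fun _ : Fin n => (0 : Fin 1)) O.one) (funext fun y => ?_)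
  exact congrFun (if_pos (Subsingleton.elim (α := Fin 1) y 0)) _

/-- Multilinearity turns the sum over families `ρ` into a sum inside each block. A block other than
`a` receives only units and returns `c i` by `bullet_unitSeq`; block `a` produces `linBullet`. -/
theorem sum_sum_term_term {n : ℕ} (r : Shuffle n) (μ : P r.k) (c : Fin r.k → ∀ n, P n)
    (f : ∀ n, P n) (a : Fin r.k) :
    ∑ ρ : ∀ i, Shuffle (fiberSize r.p i), ∑ b : Fin (ρ a).k,
      O.term r.p μ (fun i => O.term (ρ i).p (c i (ρ i).k) fun l =>
        (if (⟨i, l⟩ : Σ i, Fin (ρ i).k) = ⟨a, b⟩ then f else O.unitSeq) (fiberSize (ρ i).p l)) =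
    O.term r.p μ fun i => (if i = a then O.linBullet (c i) f else c i) (fiberSize r.p i) := by
  have h : (fun i => (if i = a then O.linBullet (c i) f else c i) (fiberSize r.p i)) =
      fun i => ∑ s : Shuffle (fiberSize r.p i), if i = a then
        ∑ b : Fin s.k, O.term s.p (c i s.k) (fun l =>
          (if l = b then f else O.unitSeq) (fiberSize s.p l))
        else O.term s.p (c i s.k) fun l => O.unitSeq (fiberSize s.p l) := by
    funext i
    split_ifs
    · rfl
    · rw [← bullet_eq_sum, bullet_unitSeq]
  rw [h, MultilinearMap.map_sum]
  refine Finset.sum_congr rfl fun ρ _ => ?_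
  have h' : (fun i => if i = a then
        ∑ b : Fin (ρ i).k, O.term (ρ i).p (c i (ρ i).k) (fun l =>
          (if l = b then f else O.unitSeq) (fiberSize (ρ i).p l))
        else O.term (ρ i).p (c i (ρ i).k) fun l => O.unitSeq (fiberSize (ρ i).p l)) =
      Function.update (fun i => O.term (ρ i).p (c i (ρ i).k) fun l =>
        O.unitSeq (fiberSize (ρ i).p l)) a
        (∑ b : Fin (ρ a).k, O.term (ρ a).p (c a (ρ a).k) (fun l =>
          (if l = b then f else O.unitSeq) (fiberSize (ρ a).p l))) := by
    funext i
    rcases eq_or_ne i a with rfl | hi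
    · rw [if_pos rfl, Function.update_self]
    · rw [if_neg hi, Function.update_of_ne hi]
  rw [h', MultilinearMap.map_update_sum]
  refine Finset.sum_congr rfl fun b _ => ?_
  congr 1
  funext i
  rcases eq_or_ne i a with rfl | hi
  · rw [Function.update_self]
    simp
  · rw [Function.update_of_ne hi]
    simp [hi]

theorem sum_term_fiberElem {n k m : ℕ} (p : Fin n → Fin k) (q : Fin k → Fin m) (μ : P m)
    (c : ∀ i, P (fiberSize q i)) (f f' : ∀ n, P n) :
    ∑ x : Fin k, O.term p (O.term q μ c) (fun z => (if z = x then f else f') (fiberSize p z)) =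
      ∑ x : Σ i, Fin (fiberSize q i), O.term (q ∘ p) μ fun i => O.term (fiberMap p q i) (c i)
        fun l => (if (⟨i, l⟩ : Σ i, Fin (fiberSize q i)) = x then f else f')
          (fiberSize (fiberMap p q i) l) := by
  rw [← (fiberElem_bijective q).sum_comp]
  refine Finset.sum_congr rfl fun x _ => ?_
  rw [term_term]
  congr 1
  funext i
  congr 1
  funext l
  rw [O.map_finCongr_seq (fiberSize_fiberMap p q i l)
    (if fiberElem q ⟨i, l⟩ = fiberElem q x then f else f')]
  simp only [(fiberElem_bijective q).1.eq_iff]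

/-- After reindexing by `split`, `g` sits in the coarse block `y` and `f` inside the coarse block
`a`. If `a = y`, then `f` is inserted into `g`; otherwise it is inserted into a unit and remains
`f`. -/
theorem linBullet_linBullet (h g f : ∀ n, P n) (hf : f 0 = 0) (n : ℕ) :
    O.linBullet (O.linBullet h g) f n = O.linBullet h (O.linBullet g f) n +
      ∑ r : Shuffle n, ∑ a : Fin r.k, ∑ y : Fin r.k, if a = y then 0 else
        O.term r.p (h r.k) fun i =>
          (if i = a then f else if i = y then g else O.unitSeq) (fiberSize r.p i) := by
  have h1 : O.linBullet (O.linBullet h g) f n = ∑ r : Shuffle n,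
      ∑ ρ : ∀ i, Shuffle (fiberSize r.p i), ∑ y : Fin r.k, ∑ c : Σ a, Fin (ρ a).k,
        O.term r.p (h r.k) fun i =>
          O.term (ρ i).p ((if i = y then g else O.unitSeq) (ρ i).k) fun l =>
            (if (⟨i, l⟩ : Σ i, Fin (ρ i).k) = c then f else O.unitSeq) (fiberSize (ρ i).p l) := by
    have h2 : O.linBullet (O.linBullet h g) f n = ∑ s : Shuffle n, ∑ t : Shuffle s.k,
        ∑ y : Fin t.k, ∑ x : Fin s.k, O.term s.p (O.term t.p (h t.k) fun i =>
          (if i = y then g else O.unitSeq) (fiberSize t.p i)) fun z =>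
          (if z = x then f else O.unitSeq) (fiberSize s.p z) := by
      refine Finset.sum_congr rfl fun s _ => ?_
      simp only [linBullet, map_sum, sum_apply]
      rw [Finset.sum_comm]
      refine Finset.sum_congr rfl fun t _ => ?_
      rw [Finset.sum_comm]
    rw [h2]
    simp only [sum_term_fiberElem]
    exact sum_split fun r ρ => ∑ y : Fin r.k, ∑ c : Σ a, Fin (ρ a).k,
        O.term r.p (h r.k) fun i =>
          O.term (ρ i).p ((if i = y then g else O.unitSeq) (ρ i).k) fun l =>
            (if (⟨i, l⟩ : Σ i, Fin (ρ i).k) = c then f else O.unitSeq) (fiberSize (ρ i).p l)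
  rw [h1, linBullet, ← Finset.sum_add_distrib]
  refine Finset.sum_congr rfl fun r _ => ?_
  rw [← Finset.sum_add_distrib]
  simp only [Fintype.sum_sigma]
  rw [Finset.sum_comm]
  have h3 : ∀ y : Fin r.k, ∑ ρ : ∀ i, Shuffle (fiberSize r.p i), ∑ a, ∑ b : Fin (ρ a).k,
      (O.term r.p (h r.k) fun i =>
          O.term (ρ i).p ((if i = y then g else O.unitSeq) (ρ i).k) fun l =>
            (if (⟨i, l⟩ : Σ i, Fin (ρ i).k) = ⟨a, b⟩ then f else O.unitSeq)
              (fiberSize (ρ i).p l)) =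
      ∑ a, O.term r.p (h r.k) fun i => (if i = a then
        O.linBullet (if i = y then g else O.unitSeq) f else if i = y then g else O.unitSeq)
          (fiberSize r.p i) := by
    intro y
    rw [Finset.sum_comm]
    exact Finset.sum_congr rfl fun a _ =>
      O.sum_sum_term_term r (h r.k) (fun i => if i = y then g else O.unitSeq) f a
  simp only [h3]
  rw [Finset.sum_comm]
  refine Finset.sum_congr rfl fun a _ => ?_
  -- The remainder is kept as a full square sum with zero diagonal, so that exchanging `f` and `g`
  -- is merely an exchange of summations.
  have hs := Finset.sum_erase (f := fun y => if a = y then 0 else O.term r.p (h r.k) fun i =>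
    (if i = a then f else if i = y then g else O.unitSeq) (fiberSize r.p i)) Finset.univ
    (if_pos (rfl : a = a))
  rw [← Finset.add_sum_erase _ _ (Finset.mem_univ a), ← hs]
  congr 1
  · congr 1
    funext i
    split_ifs <;> rfl
  · refine Finset.sum_congr rfl fun y hy => ?_
    have hne : a ≠ y := (Finset.ne_of_mem_erase hy).symm
    rw [if_neg hne]
    congr 1
    funext i
    rcases eq_or_ne i a with rfl | hi
    · rw [if_pos rfl, if_pos rfl, if_neg hne, O.linBullet_unitSeq hf]
    · rw [if_neg hi, if_neg hi]

theorem linBullet_linBullet_sub (h g f : ∀ n, P n) (hg : g 0 = 0) (hf : f 0 = 0) (n : ℕ) :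
    O.linBullet (O.linBullet h g) f n - O.linBullet h (O.linBullet g f) n =
      O.linBullet (O.linBullet h f) g n - O.linBullet h (O.linBullet f g) n := by
  rw [O.linBullet_linBullet h g f hf, O.linBullet_linBullet h f g hg, add_sub_cancel_left,
    add_sub_cancel_left]
  refine Finset.sum_congr rfl fun r _ => ?_
  rw [Finset.sum_comm]
  refine Finset.sum_congr rfl fun a _ => Finset.sum_congr rfl fun y _ => ?_
  rcases eq_or_ne a y with rfl | hne
  · simp
  · rw [if_neg hne, if_neg hne.symm]
    congr 1
    funext i
    rcases eq_or_ne i a with rfl | hi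
    · simp [hne]
    · simp [hi]

end SymmetricOperad

/-! ### Partitions with a single non-singleton block -/

namespace Shuffle

variable {n : ℕ}

/-- As long as no block repeats, every element opens a new block, so its index is its own position.
-/
theorem p_val_of_injOn {s : Shuffle n} {m : Fin n}
    (h : ∀ a ≤ m, ∀ b ≤ m, s.p a = s.p b → a = b) {a : Fin n} (ha : a ≤ m) : (s.p a : ℕ) = a := by
  induction a using WellFoundedLT.induction with
  | ind a ih =>
    rcases lt_trichotomy (s.p a : ℕ) a with hlt | heq | hlt
    · have hb : (⟨s.p a, hlt.trans a.2⟩ : Fin n) < a := hlt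
      have h1 := ih _ hb (hb.le.trans ha)
      exact absurd (h _ (hb.le.trans ha) _ ha (Fin.ext h1)) hb.ne
    · exact heq
    · obtain ⟨b, hb, hb'⟩ := s.exists_lt a ⟨a, hlt.trans (s.p a).2⟩ hlt
      have h1 := ih b hb (hb.le.trans ha)
      rw [hb'] at h1
      exact absurd (Fin.ext h1.symm) hb.ne

end Shuffle

namespace SetPart

variable {n : ℕ}

theorem size_eq_fiberSize (π : SetPart n) (i : Fin π.numBlocks) :
    π.size i = fiberSize π.index i := by
  rw [fiberSize, π.fiber_index, SetPart.size]

theorem card_filter_parts (π : SetPart n) :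
    (π.parts.filter fun B => 1 < B.card).card =
      (Finset.univ.filter fun i : Fin π.numBlocks => 1 < fiberSize π.index i).card := by
  symm
  refine Finset.card_bij (fun i _ => π.block i) ?_ ?_ ?_
  · intro i hi
    rw [Finset.mem_filter, ← size_eq_fiberSize] at hi
    exact Finset.mem_filter.2 ⟨π.block_mem_parts i, hi.2⟩
  · intro i _ j _ h
    rw [← π.index_eq_iff.2 (π.leader_mem_block i), π.index_eq_iff, ← h]
    exact π.leader_mem_block i
  · intro B hB
    rw [Finset.mem_filter] at hB
    obtain ⟨a, ha⟩ := π.nonempty_of_mem_parts hB.1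
    have hb : π.block (π.index a) = B := by rw [block_index, π.part_eq_of_mem hB.1 ha]
    refine ⟨π.index a, Finset.mem_filter.2 ⟨Finset.mem_univ _, ?_⟩, hb⟩
    rw [← size_eq_fiberSize, size, hb]
    exact hB.2

section OfSubset

variable {J : Finset (Fin n)} (hJ : J.Nonempty)

theorem mem_parts_ofSubset {B : Finset (Fin n)} :
    B ∈ (ofSubset J hJ).parts ↔ B = J ∨ ∃ a ∉ J, B = {a} := by
  simp only [ofSubset, Finpartition.extend, Finset.mem_insert, Finpartition.mem_bot_iff,
    Finset.mem_compl, eq_comm]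

theorem filter_parts_ofSubset (h : 1 < J.card) :
    ((ofSubset J hJ).parts.filter fun B => 1 < B.card) = {J} := by
  ext B
  rw [Finset.mem_filter, mem_parts_ofSubset, Finset.mem_singleton]
  constructor
  · rintro ⟨rfl | ⟨a, _, rfl⟩, hB⟩
    · rfl
    · simp at hB
  · rintro rfl
    exact ⟨Or.inl rfl, h⟩

theorem exists_ofSubset_eq {π : SetPart n} (h : (π.parts.filter fun B => 1 < B.card) = {J}) :
    ofSubset J hJ = π := by
  have hB : ∀ B ∈ π.parts, 1 < B.card ↔ B = J := fun B hB => by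
    rw [← Finset.mem_singleton, ← h, Finset.mem_filter, and_iff_right hB]
  have hJπ : J ∈ π.parts := by
    have : J ∈ π.parts.filter fun B => 1 < B.card := h ▸ Finset.mem_singleton_self J
    exact (Finset.mem_filter.1 this).1
  ext B
  rw [mem_parts_ofSubset]
  constructor
  · rintro (rfl | ⟨a, ha, rfl⟩)
    · exact hJπ
    · have hp := π.part_mem.2 (Finset.mem_univ a)
      have ha' := π.mem_part (Finset.mem_univ a)
      have : (π.part a).card ≤ 1 := by
        by_contra! hlt
        exact ha ((hB _ hp).1 hlt ▸ ha')
      rwa [← Finset.eq_singleton_iff_unique_mem.2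
        ⟨ha', fun b hb => Finset.card_le_one.1 this _ hb _ ha'⟩]
  · intro hBπ
    by_cases hc : 1 < B.card
    · exact Or.inl ((hB B hBπ).1 hc)
    · have hne := π.nonempty_of_mem_parts hBπ
      obtain ⟨a, rfl⟩ := Finset.card_eq_one.1 (le_antisymm (not_lt.1 hc) hne.card_pos)
      refine Or.inr ⟨a, fun ha => hc ?_, rfl⟩
      have : ({a} : Finset (Fin n)) = J :=
        π.eq_of_mem_parts hBπ hJπ (Finset.mem_singleton_self a) ha
      exact (hB _ hBπ).2 this

theorem part_ofSubset_of_mem {a : Fin n} (ha : a ∈ J) : (ofSubset J hJ).part a = J :=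
  Finpartition.part_eq_of_mem _ ((mem_parts_ofSubset hJ).2 (Or.inl rfl)) ha

/-- The elements up to `min J` lie in distinct blocks. This justifies the insertion position in the
definition of `star`. -/
theorem index_ofSubset_min' : ((ofSubset J hJ).index (J.min' hJ) : ℕ) = J.min' hJ := by
  refine Shuffle.p_val_of_injOn (s := (ofSubset J hJ).toShuffle) (m := J.min' hJ) ?_ le_rfl
  intro a ha b hb hab
  have hab' := (index_eq_index_iff _).1 hab
  rcases (mem_parts_ofSubset hJ).1 (Finpartition.part_mem _ |>.2 (Finset.mem_univ a)) with h | ⟨c, _, h⟩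
  · have h1 : a ∈ J := h ▸ Finpartition.mem_part _ (Finset.mem_univ a)
    rw [h] at hab'
    rw [le_antisymm ha (Finset.min'_le _ _ h1), le_antisymm hb (Finset.min'_le _ _ hab')]
  · have h1 : a ∈ (ofSubset J hJ).part a := Finpartition.mem_part _ (Finset.mem_univ a)
    rw [h, Finset.mem_singleton] at h1 hab'
    rw [h1, hab']

theorem size_ofSubset (i : Fin (ofSubset J hJ).numBlocks) :
    (ofSubset J hJ).size i = if (i : ℕ) = J.min' hJ then J.card else 1 := by
  have hmin := index_ofSubset_min' hJ
  have hblock : (ofSubset J hJ).block ((ofSubset J hJ).index (J.min' hJ)) = J := by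
    rw [block_index, part_ofSubset_of_mem hJ (J.min'_mem hJ)]
  split_ifs with h
  · obtain rfl : (ofSubset J hJ).index (J.min' hJ) = i := Fin.ext (hmin.trans h.symm)
    exact congrArg Finset.card hblock
  · rcases (mem_parts_ofSubset hJ).1 ((ofSubset J hJ).block_mem_parts i) with hi | ⟨a, _, hi⟩
    · have hi' : (ofSubset J hJ).index (J.min' hJ) = i :=
        (index_eq_iff _).2 (hi.symm ▸ J.min'_mem hJ)
      exact absurd ((congrArg Fin.val hi').symm.trans hmin) h
    · rw [size, hi, Finset.card_singleton]

end OfSubset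

end SetPart

/-! ### The product `*` as the linear part of the group product -/

namespace SymmetricOperad

variable {R : Type*} [CommRing R] {P : ℕ → Type*} [∀ n, AddCommGroup (P n)]
  [∀ n, Module R (P n)] (O : SymmetricOperad R P)

theorem lieSeq_of_le_one (f : OperadSeries P) {n : ℕ} (hn : n ≤ 1) : lieSeq f n = 0 := by
  match n, hn with
  | 0, _ => rfl
  | 1, _ => rfl

theorem groupSeq_eq_lieSeq (f : OperadSeries P) {n : ℕ} (hn : 1 < n) :
    O.groupSeq f n = lieSeq f n := by
  match n, hn with
  | n + 2, _ => rfl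

theorem groupSeq_eq_add (f : OperadSeries P) (n : ℕ) :
    O.groupSeq f n = O.unitSeq n + lieSeq f n := by
  match n with
  | 0 => exact (add_zero 0).symm
  | 1 => exact (add_zero O.one).symm
  | n + 2 => exact (zero_add (f n)).symm

/-- A summand survives only if block `x` has size at least 2, as `lieSeq f` vanishes in arity 1, and
all other blocks are singletons, as the unit vanishes in higher arities. -/
theorem sum_term_lieSeq {n : ℕ} (s : Shuffle n) (μ : P s.k) (f : OperadSeries P) :
    ∑ x : Fin s.k, O.term s.p μ (fun y => (if y = x then lieSeq f else O.unitSeq)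
      (fiberSize s.p y)) =
    if (Finset.univ.filter fun i => 1 < fiberSize s.p i).card = 1 then
      O.term s.p μ (fun i => O.groupSeq f (fiberSize s.p i)) else 0 := by
  have h0 : ∀ x, x ∉ (Finset.univ.filter fun i => 1 < fiberSize s.p i) →
      O.term s.p μ (fun y => (if y = x then lieSeq f else O.unitSeq) (fiberSize s.p y)) = 0 := by
    intro x hx
    refine O.term_eq_zero s μ (fun y => if y = x then lieSeq f else O.unitSeq) x ?_
    rw [if_pos rfl]
    exact lieSeq_of_le_one f (by simpa using hx)
  split_ifs with h
  · obtain ⟨x, hx⟩ := Finset.card_eq_one.1 h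
    have hmem : ∀ y, 1 < fiberSize s.p y ↔ y = x := fun y => by
      rw [← Finset.mem_singleton, ← hx]; simp
    rw [Fintype.sum_eq_single x fun y hy => h0 y (by rw [hx]; simpa using hy)]
    congr 1
    funext y
    split_ifs with hy
    · exact (O.groupSeq_eq_lieSeq f ((hmem y).2 hy)).symm
    · have h1 := s.fiberSize_pos y
      have h2 : ¬ 1 < fiberSize s.p y := fun h => hy ((hmem y).1 h)
      rw [show fiberSize s.p y = 1 by omega]
      rfl
  · refine Finset.sum_eq_zero fun x _ => ?_
    by_cases hx : x ∈ Finset.univ.filter fun i => 1 < fiberSize s.p i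
    · obtain ⟨y, hy, hyx⟩ := Finset.exists_mem_ne
        (lt_of_le_of_ne (Finset.card_pos.2 ⟨x, hx⟩) (Ne.symm h)) x
      refine O.term_eq_zero s μ (fun y => if y = x then lieSeq f else O.unitSeq) y ?_
      rw [if_neg hyx]
      exact O.unitSeq_of_ne_one (Finset.mem_filter.1 hy).2.ne'
    · exact h0 x hx

theorem linBullet_lieSeq (g : ∀ n, P n) (f : OperadSeries P) (n : ℕ) :
    O.linBullet g (lieSeq f) n =
      ∑ π : SetPart n with (π.parts.filter fun B => 1 < B.card).card = 1,
        O.partTerm π g (O.groupSeq f) := by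
  rw [linBullet, Finset.sum_filter]
  simp only [sum_term_lieSeq]
  rw [← sum_setPart_eq]
  refine Finset.sum_congr rfl fun π _ => ?_
  rw [π.card_filter_parts, ← term_toShuffle]
  rfl

theorem star_term (g : ∀ n, P n) (f : OperadSeries P) {n : ℕ} {J : Finset (Fin n)}
    (hJ : J.Nonempty) :
    O.map (SetPart.ofSubset J hJ).perm (O.comp (SetPart.ofSubset J hJ).size
      (g (SetPart.ofSubset J hJ).numBlocks)
        (fun i => if (i : ℕ) = (J.min' hJ : ℕ) then lieSeq f _ else O.unitSeq _)) =
    if 1 < J.card then O.partTerm (SetPart.ofSubset J hJ) g (O.groupSeq f) else 0 := by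
  have hs := SetPart.size_ofSubset hJ
  split_ifs with h
  · rw [partTerm]
    congr 2
    funext i
    split_ifs with hi
    · rw [O.groupSeq_eq_lieSeq]
      rw [hs, if_pos hi]
      exact h
    · have : (SetPart.ofSubset J hJ).size i = 1 := by rw [hs, if_neg hi]
      rw [this]
      rfl
  -- A singleton `J` inserts the arity 1 component of `lieSeq f`, which is zero.
  · rw [MultilinearMap.map_coord_zero _ ((SetPart.ofSubset J hJ).index (J.min' hJ)), map_zero]
    rw [if_pos (SetPart.index_ofSubset_min' hJ)]
    refine lieSeq_of_le_one f ?_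
    rw [hs, if_pos (SetPart.index_ofSubset_min' hJ)]
    exact not_lt.1 h

theorem star_eq_sum (f : OperadSeries P) (g : ∀ n, P n) (n : ℕ) :
    O.star (lieSeq f) g n =
      ∑ π : SetPart n with (π.parts.filter fun B => 1 < B.card).card = 1,
        O.partTerm π g (O.groupSeq f) := by
  rw [star]
  simp only [star_term]
  rw [← Finset.sum_filter]
  refine Finset.sum_bij (fun J _ => SetPart.ofSubset J.1 J.2) ?_ ?_ ?_ fun _ _ => rfl
  · intro J hJ
    rw [Finset.mem_filter, SetPart.filter_parts_ofSubset J.2 (Finset.mem_filter.1 hJ).2]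
    simp
  · intro J hJ J' hJ' h
    have h1 := SetPart.filter_parts_ofSubset J.2 (Finset.mem_filter.1 hJ).2
    rw [h, SetPart.filter_parts_ofSubset J'.2 (Finset.mem_filter.1 hJ').2] at h1
    exact Subtype.ext (Finset.singleton_injective h1).symm
  · intro π hπ
    obtain ⟨J, hJ⟩ := Finset.card_eq_one.1 (Finset.mem_filter.1 hπ).2
    have hcard : 1 < J.card := by
      have : J ∈ π.parts.filter fun B => 1 < B.card := hJ ▸ Finset.mem_singleton_self J
      exact (Finset.mem_filter.1 this).2
    exact ⟨⟨J, Finset.card_pos.1 (by omega)⟩, by simpa using hcard, SetPart.exists_ofSubset_eq _ hJ⟩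

theorem star_eq_linBullet (f : OperadSeries P) (g : ∀ n, P n) :
    O.star (lieSeq f) g = O.linBullet g (lieSeq f) := by
  funext n
  rw [star_eq_sum, linBullet_lieSeq]

/-! ### The pre-Lie algebra -/

theorem linBullet_of_le_one (f g : OperadSeries P) {n : ℕ} (hn : n ≤ 1) :
    O.linBullet (lieSeq g) (lieSeq f) n = 0 := by
  refine Finset.sum_eq_zero fun s _ => Finset.sum_eq_zero fun x _ => ?_
  rw [lieSeq_of_le_one g (s.k_le.trans hn), map_zero, zero_apply]

theorem star_lieSeq (f g : OperadSeries P) :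
    O.star (lieSeq f) (lieSeq g) = lieSeq (O.preLie f g) := by
  funext n
  match n with
  | 0 => rw [star_eq_linBullet, O.linBullet_of_le_one f g zero_le_one]; rfl
  | 1 => rw [star_eq_linBullet, O.linBullet_of_le_one f g le_rfl]; rfl
  | n + 2 => rfl

theorem preLie_apply (f g : OperadSeries P) (i : ℕ) :
    O.preLie f g i = O.linBullet (lieSeq g) (lieSeq f) (i + 2) := by
  rw [preLie, star_eq_linBullet]

theorem linBullet_lieSeq_lieSeq (f g : OperadSeries P) :
    O.linBullet (lieSeq g) (lieSeq f) = lieSeq (O.preLie f g) := by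
  rw [← star_eq_linBullet, star_lieSeq]

/-- The component of arity `n` of a sequence in `{0} × ∏_{n ≥ 2} P(n)`. -/
def lieSeqHom (R : Type*) [CommRing R] {P : ℕ → Type*} [∀ n, AddCommGroup (P n)]
    [∀ n, Module R (P n)] : ∀ n, OperadSeries P →ₗ[R] P n
  | 0 => 0
  | 1 => 0
  | n + 2 => LinearMap.proj n

theorem lieSeqHom_apply (n : ℕ) (f : OperadSeries P) : lieSeqHom R n f = lieSeq f n := by
  match n with
  | 0 => rfl
  | 1 => rfl
  | n + 2 => rfl

/-- The `Function.update` form makes linearity in `f` immediate and matches the derivative of a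
multilinear map. -/
theorem linBullet_eq_sum_update (g f : ∀ n, P n) (n : ℕ) :
    O.linBullet g f n = ∑ s : Shuffle n, ∑ x : Fin s.k, O.term s.p (g s.k)
      (Function.update (fun y => O.unitSeq (fiberSize s.p y)) x (f (fiberSize s.p x))) := by
  refine Finset.sum_congr rfl fun s _ => Finset.sum_congr rfl fun x _ => ?_
  congr 1
  funext y
  rcases eq_or_ne y x with rfl | h
  · simp
  · simp [h]

/-- The pre-Lie product as a bilinear map. -/
noncomputable def preLieHom : OperadSeries P →ₗ[R] OperadSeries P →ₗ[R] OperadSeries P :=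
  LinearMap.mk₂ R O.preLie
    (fun f f' g => by
      funext i
      simp only [Pi.add_apply, preLie_apply, linBullet_eq_sum_update, ← lieSeqHom_apply (R := R),
        map_add, MultilinearMap.map_update_add, Finset.sum_add_distrib])
    (fun c f g => by
      funext i
      simp only [Pi.smul_apply, preLie_apply, linBullet_eq_sum_update, ← lieSeqHom_apply (R := R),
        map_smul, MultilinearMap.map_update_smul, Finset.smul_sum])
    (fun f g g' => by
      funext i
      simp only [Pi.add_apply, preLie_apply, linBullet_eq_sum_update, ← lieSeqHom_apply (R := R),
        map_add, add_apply, Finset.sum_add_distrib])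
    (fun c f g => by
      funext i
      simp only [Pi.smul_apply, preLie_apply, linBullet_eq_sum_update, ← lieSeqHom_apply (R := R),
        map_smul, smul_apply, Finset.smul_sum])

theorem preLieHom_apply (f g : OperadSeries P) : O.preLieHom f g = O.preLie f g := rfl

theorem preLie_identity (f g h : OperadSeries P) :
    O.preLie (O.preLie f g) h - O.preLie f (O.preLie g h) =
      O.preLie (O.preLie g f) h - O.preLie g (O.preLie f h) := by
  funext i
  have key := O.linBullet_linBullet_sub (lieSeq h) (lieSeq g) (lieSeq f) rfl rfl (i + 2)
  simp only [linBullet_lieSeq_lieSeq] at key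
  -- Since `linBullet` takes its arguments in the opposite order to `preLie`, `key` equates the
  -- negatives of the two associators.
  exact neg_injective ((neg_sub _ _).trans (key.trans (neg_sub _ _).symm))

theorem bracket_self (f : OperadSeries P) : O.bracket f f = 0 := sub_self _

theorem bracket_jacobi (f g h : OperadSeries P) :
    O.bracket f (O.bracket g h) + O.bracket g (O.bracket h f) + O.bracket h (O.bracket f g) = 0 := by
  have h1 := O.preLie_identity f g h
  have h2 := O.preLie_identity g h f
  have h3 := O.preLie_identity h f g
  simp only [bracket, ← preLieHom_apply, map_sub, LinearMap.sub_apply] at h1 h2 h3 ⊢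
  linear_combination (norm := module) (-1 : ℤ) • h1 + (-1 : ℤ) • h2 + (-1 : ℤ) • h3

end SymmetricOperad

namespace SymmetricOperad

section Algebra

variable {R : Type*} [CommRing R] {P : ℕ → Type*} [∀ n, AddCommGroup (P n)]
  [∀ n, Module R (P n)] (O : SymmetricOperad R P)

/-! ### The group of series and its truncations -/

theorem groupSeq_injective : Function.Injective O.groupSeq := fun _ _ h =>
  funext fun i => congrFun h (i + 2)

/-- The product on `H(P)`. -/
noncomputable def mul (g f : OperadSeries P) : OperadSeries P := fun i =>
  O.bullet (O.groupSeq g) (O.groupSeq f) (i + 2)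

/-- The inverse on `H(P)`. -/
noncomputable def inv (f : OperadSeries P) : OperadSeries P := fun i =>
  O.leftInv (O.groupSeq f) (i + 2)

theorem groupSeq_mul (g f : OperadSeries P) :
    O.groupSeq (O.mul g f) = O.bullet (O.groupSeq g) (O.groupSeq f) := by
  funext n
  match n with
  | 0 => exact (O.bullet_of_le_one (O.groupSeq g) (f := O.groupSeq f) rfl zero_le_one).symm
  | 1 => exact (O.bullet_of_le_one (O.groupSeq g) (f := O.groupSeq f) rfl le_rfl).symm
  | n + 2 => rfl

theorem groupSeq_inv (f : OperadSeries P) : O.groupSeq (O.inv f) = O.leftInv (O.groupSeq f) := by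
  funext n
  match n with
  | 0 => exact (O.leftInv_of_le_one (f := O.groupSeq f) rfl zero_le_one).symm
  | 1 => exact (O.leftInv_of_le_one (f := O.groupSeq f) rfl le_rfl).symm
  | n + 2 => rfl

theorem mul_assoc' (h g f : OperadSeries P) : O.mul (O.mul h g) f = O.mul h (O.mul g f) :=
  O.groupSeq_injective (by simp only [groupSeq_mul, bullet_assoc])

theorem zero_mul' (f : OperadSeries P) : O.mul 0 f = f :=
  O.groupSeq_injective ((O.groupSeq_mul 0 f).trans (O.unitSeq_bullet rfl))

theorem inv_mul' (f : OperadSeries P) : O.mul (O.inv f) f = 0 :=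
  O.groupSeq_injective (by rw [groupSeq_mul, groupSeq_inv, leftInv_bullet _ rfl]; rfl)

/-- The group `H(P)`. -/
@[reducible] noncomputable def seriesGroup : Group (OperadSeries P) :=
  letI : Mul (OperadSeries P) := ⟨O.mul⟩
  letI : One (OperadSeries P) := ⟨0⟩
  letI : Inv (OperadSeries P) := ⟨O.inv⟩
  Group.ofLeftAxioms O.mul_assoc' O.zero_mul' O.inv_mul'

theorem leftInv_congr {f f' : ∀ n, P n} {n : ℕ} (h : ∀ m ≤ n, f m = f' m) :
    O.leftInv f n = O.leftInv f' n := by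
  induction n using Nat.strong_induction_on with
  | h n ih =>
    rw [leftInv, leftInv]
    congr 1
    refine Finset.sum_congr rfl fun s _ => ?_
    rw [ih _ s.2 fun m hm => h m (hm.trans s.2.le)]
    congr 1
    exact funext fun i => h _ (fiberSize_le _ _)

theorem linBullet_congr {g g' f f' : ∀ n, P n} {n : ℕ} (hg : ∀ m ≤ n, g m = g' m)
    (hf : ∀ m ≤ n, f m = f' m) : O.linBullet g f n = O.linBullet g' f' n := by
  simp only [linBullet_eq_sum_update]
  refine Finset.sum_congr rfl fun s _ => Finset.sum_congr rfl fun x _ => ?_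
  rw [hg _ s.k_le, hf _ (fiberSize_le _ _)]

/-- Extension of a truncated series by zero. -/
def extend {P : ℕ → Type*} [∀ n, Zero (P n)] {r : ℕ} (x : TruncSeries P r) : OperadSeries P :=
  fun i => if h : i < r then x ⟨i, h⟩ else 0

@[simp] theorem truncate_extend {r : ℕ} (x : TruncSeries P r) : truncate r (extend x) = x := by
  funext i
  exact dif_pos i.2

theorem truncate_surjective (r : ℕ) : Function.Surjective (truncate (P := P) r) := fun x =>
  ⟨extend x, truncate_extend x⟩

theorem truncate_eq_iff {P : ℕ → Type*} {r : ℕ} {f f' : OperadSeries P} :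
    truncate r f = truncate r f' ↔ ∀ i < r, f i = f' i :=
  ⟨fun h i hi => congrFun h ⟨i, hi⟩, fun h => funext fun i => h i i.2⟩

/-- Component `i` of a series has arity `i + 2`, so arities up to `i + 2` involve only components
with index below `r`. -/
theorem groupSeq_congr {r : ℕ} {f f' : OperadSeries P} (h : truncate r f = truncate r f') {i : ℕ}
    (hi : i < r) {m : ℕ} (hm : m ≤ i + 2) : O.groupSeq f m = O.groupSeq f' m := by
  match m with
  | 0 => rfl
  | 1 => rfl
  | m + 2 => exact truncate_eq_iff.1 h m (by omega)

theorem lieSeq_congr {r : ℕ} {f f' : OperadSeries P} (h : truncate r f = truncate r f') {i : ℕ}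
    (hi : i < r) {m : ℕ} (hm : m ≤ i + 2) : lieSeq f m = lieSeq f' m := by
  match m with
  | 0 => rfl
  | 1 => rfl
  | m + 2 => exact truncate_eq_iff.1 h m (by omega)

/-- The product of truncated series. -/
noncomputable def truncMul {r : ℕ} (x y : TruncSeries P r) : TruncSeries P r :=
  truncate r (O.mul (extend x) (extend y))

/-- The inverse of a truncated series. -/
noncomputable def truncInv {r : ℕ} (x : TruncSeries P r) : TruncSeries P r :=
  truncate r (O.inv (extend x))

/-- A partition of an `n`-element set has at most `n` blocks, each of size at most `n`, so the
product never looks at higher arities. All group laws pass to truncations this way. -/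
theorem truncate_mul (r : ℕ) (g f : OperadSeries P) :
    truncate r (O.mul g f) = O.truncMul (truncate r g) (truncate r f) :=
  truncate_eq_iff.2 fun _ hi => O.bullet_congr
    (fun _ hm => O.groupSeq_congr (truncate_extend _).symm hi hm)
    (fun _ hm => O.groupSeq_congr (truncate_extend _).symm hi hm)

theorem truncate_inv (r : ℕ) (f : OperadSeries P) :
    truncate r (O.inv f) = O.truncInv (truncate r f) :=
  truncate_eq_iff.2 fun _ hi => O.leftInv_congr
    (fun _ hm => O.groupSeq_congr (truncate_extend _).symm hi hm)

theorem truncate_preLie (r : ℕ) {f f' g g' : OperadSeries P} (hf : truncate r f = truncate r f')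
    (hg : truncate r g = truncate r g') : truncate r (O.preLie f g) = truncate r (O.preLie f' g') := by
  refine truncate_eq_iff.2 fun i hi => ?_
  rw [preLie_apply, preLie_apply]
  exact O.linBullet_congr (fun _ hm => lieSeq_congr hg hi hm) (fun _ hm => lieSeq_congr hf hi hm)

/-- The group of truncated series. -/
@[reducible] noncomputable def truncGroup (r : ℕ) : Group (TruncSeries P r) :=
  letI : Mul (TruncSeries P r) := ⟨O.truncMul⟩
  letI : One (TruncSeries P r) := ⟨0⟩
  letI : Inv (TruncSeries P r) := ⟨O.truncInv⟩
  Group.ofLeftAxioms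
    (fun x y z => by
      obtain ⟨x, rfl⟩ := truncate_surjective r x
      obtain ⟨y, rfl⟩ := truncate_surjective r y
      obtain ⟨z, rfl⟩ := truncate_surjective r z
      change O.truncMul (O.truncMul _ _) _ = O.truncMul _ (O.truncMul _ _)
      simp only [← truncate_mul, mul_assoc'])
    (fun x => by
      obtain ⟨x, rfl⟩ := truncate_surjective r x
      exact (O.truncate_mul r 0 x).symm.trans (congrArg _ (O.zero_mul' x)))
    (fun x => by
      obtain ⟨x, rfl⟩ := truncate_surjective r x
      change O.truncMul (O.truncInv _) _ = 0
      rw [← truncate_inv, ← truncate_mul, inv_mul']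
      rfl)

/-- The sequence in `{0} × ∏_{n ≥ 2} P(n)` of a truncated series, as a linear map. -/
def truncSeqHom (R : Type*) [CommRing R] (P : ℕ → Type*) [∀ n, AddCommGroup (P n)]
    [∀ n, Module R (P n)] (r : ℕ) : TruncSeries P r →ₗ[R] ∀ n, P n :=
  LinearMap.pi fun n => lieSeqHom R n ∘ₗ
    { toFun := extend
      map_add' := fun x y => by
        funext i
        by_cases h : i < r <;> simp [extend, h]
      map_smul' := fun c x => by
        funext i
        by_cases h : i < r <;> simp [extend, h] }

theorem truncSeqHom_apply {r : ℕ} (x : TruncSeries P r) :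
    truncSeqHom R P r x = lieSeq (extend x) :=
  funext fun n => lieSeqHom_apply n (extend x)

/-- The product as a linear map of its left factor. -/
noncomputable def bulletHom (f : ∀ n, P n) (n : ℕ) : (∀ n, P n) →ₗ[R] P n where
  toFun g := O.bullet g f n
  map_add' g g' := by simp [bullet_eq_sum, Finset.sum_add_distrib]
  map_smul' c g := by simp [bullet_eq_sum, Finset.smul_sum]

/-- The linear part of the product as a linear map of its left factor. -/
noncomputable def linBulletHom (f : ∀ n, P n) (n : ℕ) : (∀ n, P n) →ₗ[R] P n where
  toFun g := O.linBullet g f n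
  map_add' g g' := by simp [linBullet, Finset.sum_add_distrib]
  map_smul' c g := by simp [linBullet, Finset.smul_sum]

theorem groupSeq_extend_zero (r : ℕ) : O.groupSeq (extend (0 : TruncSeries P r)) = O.unitSeq := by
  congr 1
  funext i
  simp [extend]

theorem lieSeq_extend {r : ℕ} (v : TruncSeries P r) (i : Fin r) : lieSeq (extend v) (i + 2) = v i :=
  dif_pos i.2

theorem truncate_bracket_extend (r : ℕ) (f g : OperadSeries P) :
    truncate r (O.bracket (extend (truncate r f)) (extend (truncate r g))) =
      truncate r (O.bracket f g) :=
  congrArg₂ (fun x y : TruncSeries P r => x - y)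
    (O.truncate_preLie r (truncate_extend _) (truncate_extend _))
    (O.truncate_preLie r (truncate_extend _) (truncate_extend _))

theorem bulletHom_apply (g f : ∀ n, P n) (n : ℕ) : O.bulletHom f n g = O.bullet g f n := rfl

theorem linBulletHom_apply (g f : ∀ n, P n) (n : ℕ) : O.linBulletHom f n g = O.linBullet g f n :=
  rfl

end Algebra

end SymmetricOperad

/-! ### Multilinear maps on finite dimensional spaces -/

/-- The existential form lets the derivatives remain unnamed; only their values at `v` matter. -/
theorem fderiv_apply_of_hasFDerivAt {𝕜 ι : Type*} [RCLike 𝕜] [Fintype ι] {E : ι → Type*}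
    [∀ i, NormedAddCommGroup (E i)] [∀ i, NormedSpace 𝕜 (E i)] {G : Type*} [NormedAddCommGroup G]
    [NormedSpace 𝕜 G] {f : G → ∀ i, E i} {x v : G} {w : ∀ i, E i}
    (h : ∀ i, ∃ L, HasFDerivAt (𝕜 := 𝕜) (fun y => f y i) L x ∧ L v = w i) :
    fderiv 𝕜 f x v = w := by
  choose L hL hv using h
  rw [(hasFDerivAt_pi.2 hL).fderiv]
  exact funext hv

section Multilinear

variable {𝕜 : Type*} [RCLike 𝕜] {ι : Type*} [Fintype ι] {E : ι → Type*}
  [∀ i, NormedAddCommGroup (E i)] [∀ i, NormedSpace 𝕜 (E i)] [∀ i, FiniteDimensional 𝕜 (E i)]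
  {F : Type*} [NormedAddCommGroup F] [NormedSpace 𝕜 F]

theorem MultilinearMap.continuous_of_finiteDimensional (f : MultilinearMap 𝕜 E F) :
    Continuous f := by
  classical
  let b := fun i => Module.finBasis 𝕜 (E i)
  have h : (f : (∀ i, E i) → F) = fun x => ∑ r : ∀ i, Fin (Module.finrank 𝕜 (E i)),
      (∏ i, (b i).repr (x i) (r i)) • f fun i => b i (r i) := by
    funext x
    conv_lhs => rw [show x = fun i => ∑ j, (b i).repr (x i) j • b i j from
      funext fun i => ((b i).sum_repr (x i)).symm]
    rw [MultilinearMap.map_sum]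
    exact Finset.sum_congr rfl fun r _ => f.map_smul_univ _ _
  rw [h]
  refine continuous_finsetSum _ fun r _ => Continuous.smul ?_ continuous_const
  refine continuous_finsetProd _ fun i _ => ?_
  exact (LinearMap.continuous_of_finiteDimensional ((b i).coord (r i))).comp (continuous_apply i)

/-- A multilinear map on finite dimensional spaces as a continuous multilinear map. -/
def MultilinearMap.toContinuous (f : MultilinearMap 𝕜 E F) : ContinuousMultilinearMap 𝕜 E F :=
  ⟨f, f.continuous_of_finiteDimensional⟩

end Multilinear

namespace SymmetricOperad

section Analysis

variable {𝕜 : Type*} [RCLike 𝕜] {P : ℕ → Type*} [∀ n, NormedAddCommGroup (P n)]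
  [∀ n, NormedSpace 𝕜 (P n)] [∀ n, FiniteDimensional 𝕜 (P n)] (O : SymmetricOperad 𝕜 P)
  {E : Type*} [NormedAddCommGroup E] [NormedSpace 𝕜 E]

/-! ### Analyticity of the group operations -/

/-- Expanding `a x` in a basis of `P k` reduces joint analyticity to scalar coordinates times fixed
continuous multilinear maps. -/
theorem contDiff_term {n k : ℕ} (p : Fin n → Fin k) {a : E → P k}
    {b : ∀ i, E → P (fiberSize p i)} (ha : ContDiff 𝕜 ω a) (hb : ∀ i, ContDiff 𝕜 ω (b i)) :
    ContDiff 𝕜 ω fun x => O.term p (a x) fun i => b i x := by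
  let e := Module.finBasis 𝕜 (P k)
  have h : (fun x => O.term p (a x) fun i => b i x) = fun x => ∑ j,
      LinearMap.toContinuousLinearMap (e.coord j) (a x) •
        (O.term p (e j)).toContinuous fun i => b i x := by
    funext x
    conv_lhs => rw [← e.sum_repr (a x)]
    rw [map_sum, sum_apply]
    refine Finset.sum_congr rfl fun j _ => ?_
    rw [map_smul]
    rfl
  rw [h]
  refine ContDiff.sum fun j _ => ContDiff.smul ?_ ?_
  · exact (ContinuousLinearMap.contDiff _).comp ha
  · exact (ContinuousMultilinearMap.contDiff _).comp (contDiff_pi.2 hb)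

theorem contDiff_bullet {g f : E → ∀ n, P n} (hg : ∀ n, ContDiff 𝕜 ω fun x => g x n)
    (hf : ∀ n, ContDiff 𝕜 ω fun x => f x n) (n : ℕ) :
    ContDiff 𝕜 ω fun x => O.bullet (g x) (f x) n := by
  simp only [bullet_eq_sum]
  exact ContDiff.sum fun s _ => O.contDiff_term s.p (hg _) fun i => hf _

theorem contDiff_leftInv {f : E → ∀ n, P n} (hf : ∀ n, ContDiff 𝕜 ω fun x => f x n) (n : ℕ) :
    ContDiff 𝕜 ω fun x => O.leftInv (f x) n := by
  induction n using Nat.strong_induction_on with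
  | h n ih =>
    have h : (fun x => O.leftInv (f x) n) = fun x => O.unitSeq n -
        ∑ s : {s : Shuffle n // s.k < n}, O.term s.1.p (O.leftInv (f x) s.1.k)
          fun i => f x (fiberSize s.1.p i) := funext fun x => by rw [leftInv]
    rw [h]
    exact contDiff_const.sub (ContDiff.sum fun s _ => O.contDiff_term s.1.p (ih _ s.2) fun i => hf _)

/-- The map `x ↦ groupSeq (extend x)` is affine. Composing with `Λ` lands in a normed space; besides
coordinates, `Λ` will be `bulletHom` and `linBulletHom`. -/
theorem hasFDerivAt_groupSeq {r n : ℕ} (Λ : (∀ n, P n) →ₗ[𝕜] P n) (x : TruncSeries P r) :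
    HasFDerivAt (fun x : TruncSeries P r => Λ (O.groupSeq (extend x)))
      (LinearMap.toContinuousLinearMap (Λ ∘ₗ truncSeqHom 𝕜 P r)) x := by
  have h : (fun x : TruncSeries P r => Λ (O.groupSeq (extend x))) = fun x => Λ O.unitSeq +
      LinearMap.toContinuousLinearMap (Λ ∘ₗ truncSeqHom 𝕜 P r) x := by
    funext x
    rw [show O.groupSeq (extend x) = O.unitSeq + lieSeq (extend x) from
      funext fun n => O.groupSeq_eq_add _ n, map_add, ← truncSeqHom_apply (R := 𝕜)]
    rfl
  rw [h]
  exact (ContinuousLinearMap.hasFDerivAt _).const_add _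

theorem contDiff_groupSeq {r : ℕ} (n : ℕ) :
    ContDiff 𝕜 ω fun x : TruncSeries P r => O.groupSeq (extend x) n := by
  have h : (fun x : TruncSeries P r => O.groupSeq (extend x) n) = fun x => O.unitSeq n +
      LinearMap.toContinuousLinearMap (LinearMap.proj n ∘ₗ truncSeqHom 𝕜 P r) x := by
    funext x
    rw [O.groupSeq_eq_add, ← truncSeqHom_apply (R := 𝕜)]
    rfl
  rw [h]
  exact contDiff_const.add (ContinuousLinearMap.contDiff _)

theorem contDiff_truncMul (r : ℕ) :
    ContDiff 𝕜 ω fun x : TruncSeries P r × TruncSeries P r => O.truncMul x.1 x.2 :=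
  contDiff_pi.2 fun i => O.contDiff_bullet (fun n => (O.contDiff_groupSeq n).comp contDiff_fst)
    (fun n => (O.contDiff_groupSeq n).comp contDiff_snd) (i + 2)

theorem contDiff_truncInv (r : ℕ) : ContDiff 𝕜 ω fun x : TruncSeries P r => O.truncInv x :=
  contDiff_pi.2 fun i => O.contDiff_leftInv (fun n => O.contDiff_groupSeq n) (i + 2)

/-! ### Derivatives of the product -/

/-- The derivative of a multilinear map perturbs one input at a time; at the unit the other inputs
are units, which is exactly `linBullet`. -/
theorem hasFDerivAt_bullet (g : ∀ n, P n) {F : E → ∀ n, P n} {F' : ∀ n, E →L[𝕜] P n} {x : E}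
    (hF : ∀ n, HasFDerivAt (fun y => F y n) (F' n) x) (hx : F x = O.unitSeq) (n : ℕ) :
    ∃ L : E →L[𝕜] P n, HasFDerivAt (fun y => O.bullet g (F y) n) L x ∧
      ∀ v, L v = O.linBullet g (fun n => F' n v) n := by
  have h : ∀ s : Shuffle n, HasFDerivAt
      (fun y => O.term s.p (g s.k) fun i => F y (fiberSize s.p i)) _ x := fun s =>
    HasFDerivAt.multilinear_comp (O.term s.p (g s.k)).toContinuous fun i => hF (fiberSize s.p i)
  simp only [bullet_eq_sum]
  refine ⟨_, HasFDerivAt.fun_sum fun s _ => h s, fun v => ?_⟩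
  rw [linBullet_eq_sum_update, sum_apply]
  refine Finset.sum_congr rfl fun s _ => ?_
  rw [sum_apply]
  refine Finset.sum_congr rfl fun i _ => ?_
  rw [hx]
  rfl

theorem hasFDerivAt_bullet_groupSeq {r : ℕ} (g : ∀ n, P n) (n : ℕ) :
    ∃ L : TruncSeries P r →L[𝕜] P n,
      HasFDerivAt (fun x : TruncSeries P r => O.bullet g (O.groupSeq (extend x)) n) L 0 ∧
      ∀ v, L v = O.linBullet g (lieSeq (extend v)) n := by
  obtain ⟨L, hL, hv⟩ := O.hasFDerivAt_bullet g (F := fun x : TruncSeries P r =>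
    O.groupSeq (extend x)) (fun n => O.hasFDerivAt_groupSeq (LinearMap.proj n) 0) (x := 0) (by
      congr 1
      funext i
      simp [extend]) n
  refine ⟨L, hL, fun v => (hv v).trans ?_⟩
  rw [← truncSeqHom_apply (R := 𝕜)]
  rfl

/-- The derivative of left multiplication. -/
theorem fderiv_truncMul_left {r : ℕ} (g v : TruncSeries P r) :
    fderiv 𝕜 (fun x => O.truncMul g x) 0 v =
      fun i : Fin r => O.linBullet (O.groupSeq (extend g)) (lieSeq (extend v)) (i + 2) :=
  fderiv_apply_of_hasFDerivAt fun i => by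
    obtain ⟨L, hL, hv⟩ := O.hasFDerivAt_bullet_groupSeq (r := r) (O.groupSeq (extend g)) (i + 2)
    exact ⟨L, hL, hv v⟩

/-- The derivative of right multiplication. -/
theorem fderiv_truncMul_right {r : ℕ} (g v : TruncSeries P r) :
    fderiv 𝕜 (fun x => O.truncMul x g) 0 v =
      fun i : Fin r => O.bullet (lieSeq (extend v)) (O.groupSeq (extend g)) (i + 2) :=
  fderiv_apply_of_hasFDerivAt fun i => by
    have h := O.hasFDerivAt_groupSeq (r := r) (O.bulletHom (O.groupSeq (extend g)) (i + 2)) 0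
    simp only [bulletHom_apply] at h
    refine ⟨_, h, ?_⟩
    rw [← truncSeqHom_apply (R := 𝕜)]
    rfl

theorem fderiv_truncMul_right_zero {r : ℕ} (v : TruncSeries P r) :
    fderiv 𝕜 (fun x => O.truncMul x 0) 0 v = v := by
  rw [fderiv_truncMul_right, groupSeq_extend_zero, bullet_unitSeq]
  exact funext (lieSeq_extend v)

theorem fderiv_truncMul_left_zero {r : ℕ} (v : TruncSeries P r) :
    fderiv 𝕜 (fun x => O.truncMul 0 x) 0 v = v := by
  rw [fderiv_truncMul_left, groupSeq_extend_zero, linBullet_unitSeq _ rfl]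
  exact funext (lieSeq_extend v)

/-- The right-invariant field is `g ↦ w • g`, so its derivative at the unit is the linear part of
the product in its right factor. -/
theorem fderiv_fderiv_truncMul_right {r : ℕ} (v w : TruncSeries P r) :
    fderiv 𝕜 (fun g => fderiv 𝕜 (fun x => O.truncMul x g) 0 w) 0 v =
      truncate r (O.preLie (extend v) (extend w)) := by
  simp only [fderiv_truncMul_right]
  refine fderiv_apply_of_hasFDerivAt fun i => ?_
  obtain ⟨L, hL, hv⟩ := O.hasFDerivAt_bullet_groupSeq (r := r) (lieSeq (extend w)) (i + 2)
  refine ⟨L, hL, ?_⟩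
  rw [hv v, truncate, preLie_apply]

/-- The left-invariant field `g ↦ linBullet g w` is affine in `g`, so differentiating replaces `g`
by `v`. The roles of `v` and `w` are swapped compared with right translation. -/
theorem fderiv_fderiv_truncMul_left {r : ℕ} (v w : TruncSeries P r) :
    fderiv 𝕜 (fun g => fderiv 𝕜 (fun x => O.truncMul g x) 0 w) 0 v =
      truncate r (O.preLie (extend w) (extend v)) := by
  simp only [fderiv_truncMul_left]
  refine fderiv_apply_of_hasFDerivAt fun i => ?_
  have h := O.hasFDerivAt_groupSeq (r := r) (O.linBulletHom (lieSeq (extend w)) (i + 2)) 0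
  simp only [linBulletHom_apply] at h
  refine ⟨_, h, ?_⟩
  rw [truncate, preLie_apply, ← truncSeqHom_apply (R := 𝕜) v]
  rfl

/-- The bracket of right-invariant vector fields. -/
theorem lieBracket_right {r : ℕ} (v w : TruncSeries P r) :
    VectorField.lieBracket 𝕜
      (fun g => fderiv 𝕜 (fun x => O.truncMul x g) 0 v)
      (fun g => fderiv 𝕜 (fun x => O.truncMul x g) 0 w) 0 =
    truncate r (O.bracket (extend v) (extend w)) := by
  -- The bracket of fields is `DW(V) - DV(W)`, here `v * w - w * v`.
  rw [VectorField.lieBracket, fderiv_truncMul_right_zero, fderiv_truncMul_right_zero,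
    fderiv_fderiv_truncMul_right, fderiv_fderiv_truncMul_right]
  rfl

/-- The bracket of left-invariant vector fields. -/
theorem lieBracket_left {r : ℕ} (v w : TruncSeries P r) :
    VectorField.lieBracket 𝕜
      (fun g => fderiv 𝕜 (fun x => O.truncMul g x) 0 v)
      (fun g => fderiv 𝕜 (fun x => O.truncMul g x) 0 w) 0 =
    -truncate r (O.bracket (extend v) (extend w)) := by
  rw [VectorField.lieBracket, fderiv_truncMul_left_zero, fderiv_truncMul_left_zero,
    fderiv_fderiv_truncMul_left, fderiv_fderiv_truncMul_left]
  exact (neg_sub _ _).symm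

end Analysis

end SymmetricOperad

namespace SymmetricOperad

section LieGroup

variable {𝕜 : Type*} [RCLike 𝕜] {P : ℕ → Type*} [∀ n, NormedAddCommGroup (P n)]
  [∀ n, NormedSpace 𝕜 (P n)] [∀ n, FiniteDimensional 𝕜 (P n)] (O : SymmetricOperad 𝕜 P)

/-! ### The pro-Lie group -/

theorem lieGroup_trunc (r : ℕ) :
    letI := O.truncGroup r
    LieGroup 𝓘(𝕜, TruncSeries P r) ω (TruncSeries P r) := by
  let := O.truncGroup r
  exact
    { contMDiff_mul := by
        rw [← modelWithCornersSelf_prod, chartedSpaceSelf_prod]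
        exact (O.contDiff_truncMul r).contMDiff
      contMDiff_inv := (O.contDiff_truncInv r).contMDiff }

theorem continuous_truncate (r : ℕ) : Continuous (truncate (P := P) r) :=
  continuous_pi fun i => continuous_apply (i : ℕ)

theorem isTopologicalGroup_series :
    letI := O.seriesGroup
    IsTopologicalGroup (OperadSeries P) := by
  let := O.seriesGroup
  exact
    { continuous_mul := continuous_pi fun i => by
        -- Component `i` is the last component of the truncation to `i + 1` terms, where
        -- multiplication is analytic.
        have h : (fun x : OperadSeries P × OperadSeries P => O.mul x.1 x.2 i) = fun x =>
            O.truncMul (truncate (i + 1) x.1) (truncate (i + 1) x.2) (Fin.last i) :=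
          funext fun x => congrFun (O.truncate_mul (i + 1) x.1 x.2) (Fin.last i)
        refine Eq.mpr (congrArg Continuous h) ?_
        exact (continuous_apply _).comp ((O.contDiff_truncMul (i + 1)).continuous.comp
          (((continuous_truncate _).comp continuous_fst).prodMk
            ((continuous_truncate _).comp continuous_snd)))
      continuous_inv := continuous_pi fun i => by
        have h : (fun x : OperadSeries P => O.inv x i) = fun x =>
            O.truncInv (truncate (i + 1) x) (Fin.last i) :=
          funext fun x => congrFun (O.truncate_inv (i + 1) x) (Fin.last i)
        refine Eq.mpr (congrArg Continuous h) ?_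
        exact (continuous_apply _).comp ((O.contDiff_truncInv (i + 1)).continuous.comp
          (continuous_truncate _)) }

/-- The truncation homomorphism from the group of series. -/
noncomputable def truncateHom (r : ℕ) :
    letI := O.seriesGroup
    letI := O.truncGroup r
    OperadSeries P →* TruncSeries P r :=
  letI := O.seriesGroup
  letI := O.truncGroup r
  { toFun := truncate r
    map_one' := rfl
    map_mul' := O.truncate_mul r }

/-- The truncation homomorphism between groups of truncated series. -/
noncomputable def truncateSuccHom (r : ℕ) :
    letI := O.truncGroup (r + 1)
    letI := O.truncGroup r
    TruncSeries P (r + 1) →* TruncSeries P r :=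
  letI := O.truncGroup (r + 1)
  letI := O.truncGroup r
  { toFun := truncateSucc r
    map_one' := rfl
    map_mul' := fun x y => by
      obtain ⟨x, rfl⟩ := truncate_surjective (r + 1) x
      obtain ⟨y, rfl⟩ := truncate_surjective (r + 1) y
      exact (congrArg (truncateSucc r) (O.truncate_mul (r + 1) x y).symm).trans
        (O.truncate_mul r x y) }

/-- The inverse limit of the truncated series consists of the series. -/
theorem exists_truncate_eq {P : ℕ → Type*} {x : ∀ r, TruncSeries P r} (hx : ∀ r, truncateSucc r (x (r + 1)) = x r) :
    ∃ f : OperadSeries P, ∀ r, truncate r f = x r := by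
  -- Component `i` first appears at level `i + 1`, as the last one there.
  refine ⟨fun i => x (i + 1) (Fin.last i), fun r => ?_⟩
  induction r with
  | zero => exact funext fun i => i.elim0
  | succ r ih =>
    funext i
    refine Fin.lastCases rfl (fun i => ?_) i
    exact (congrFun ih i).trans (congrFun (hx r) i).symm

theorem isEmbedding_truncate :
    Topology.IsEmbedding fun (f : OperadSeries P) r => truncate r f := by
  refine Topology.IsEmbedding.of_leftInverse (f := fun x i => x (i + 1) (Fin.last i))
    (fun f => rfl) ?_ ?_
  · exact continuous_pi fun i => (continuous_apply (Fin.last i)).comp (continuous_apply (i + 1))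
  · exact continuous_pi fun r => continuous_truncate r

/-- The truncation of truncated series as a continuous linear map. -/
def truncateSuccCLM (𝕜 : Type*) [RCLike 𝕜] (P : ℕ → Type*) [∀ n, NormedAddCommGroup (P n)]
    [∀ n, NormedSpace 𝕜 (P n)] (r : ℕ) : TruncSeries P (r + 1) →L[𝕜] TruncSeries P r :=
  ContinuousLinearMap.pi fun i => ContinuousLinearMap.proj i.castSucc

theorem mfderiv_truncateSucc {𝕜 : Type*} [RCLike 𝕜] {P : ℕ → Type*}
    [∀ n, NormedAddCommGroup (P n)] [∀ n, NormedSpace 𝕜 (P n)] (r : ℕ) (x v : TruncSeries P (r + 1)) :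
    (mfderiv 𝓘(𝕜, TruncSeries P (r + 1)) 𝓘(𝕜, TruncSeries P r) (truncateSucc r) x : _ → _) v =
      truncateSucc r v := by
  rw [mfderiv_eq_fderiv]
  exact congrArg (· v) (truncateSuccCLM 𝕜 P r).fderiv

theorem _root_.VectorField.mlieBracket_eq_lieBracket {𝕜 : Type*} [RCLike 𝕜] {E : Type*}
    [NormedAddCommGroup E] [NormedSpace 𝕜 E] (V W : ∀ x : E, TangentSpace 𝓘(𝕜, E) x) :
    VectorField.mlieBracket 𝓘(𝕜, E) V W = VectorField.lieBracket 𝕜 V W := by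
  rw [← VectorField.mlieBracketWithin_univ, VectorField.mlieBracketWithin_eq_lieBracketWithin]
  exact VectorField.lieBracketWithin_univ

/-- The truncated group is a vector space with the identity chart and unit `0`, so manifold
derivatives and brackets reduce to those computed in `lieBracket_right`. -/
theorem rightInvariantBracket_trunc (r : ℕ) (v w : TruncSeries P r) :
    letI := O.truncGroup r
    rightInvariantBracket (I := 𝓘(𝕜, TruncSeries P r)) (G := TruncSeries P r) v w =
      truncate r (O.bracket (extend v) (extend w)) := by
  let := O.truncGroup r
  have h : ∀ v : TruncSeries P r, rightInvariantVectorField (I := 𝓘(𝕜, TruncSeries P r))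
      (G := TruncSeries P r) v = fun g => fderiv 𝕜 (fun x => O.truncMul x g) 0 v := by
    intro v
    funext g
    exact congrArg (fun L : TruncSeries P r →L[𝕜] TruncSeries P r => L v)
      (mfderiv_eq_fderiv (f := fun x => O.truncMul x g) (x := 0))
  refine Eq.trans ?_ (O.lieBracket_right v w)
  rw [← h v, ← h w]
  exact congrFun (VectorField.mlieBracket_eq_lieBracket _ _) _

theorem leftInvariantBracket_trunc (r : ℕ) (v w : TruncSeries P r) :
    letI := O.truncGroup r
    @Bracket.bracket (GroupLieAlgebra 𝓘(𝕜, TruncSeries P r) (TruncSeries P r))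
      (GroupLieAlgebra 𝓘(𝕜, TruncSeries P r) (TruncSeries P r)) _ v w =
      -truncate r (O.bracket (extend v) (extend w)) := by
  let := O.truncGroup r
  have h : ∀ v : TruncSeries P r, mulInvariantVectorField (I := 𝓘(𝕜, TruncSeries P r))
      (G := TruncSeries P r) v = fun g => fderiv 𝕜 (fun x => O.truncMul g x) 0 v := by
    intro v
    funext g
    exact congrArg (fun L : TruncSeries P r →L[𝕜] TruncSeries P r => L v)
      (mfderiv_eq_fderiv (f := fun x => O.truncMul g x) (x := 0))
  refine (GroupLieAlgebra.bracket_def _ _).trans (Eq.trans ?_ (O.lieBracket_left v w))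
  rw [← h v, ← h w]
  exact congrFun (VectorField.mlieBracket_eq_lieBracket _ _) _

/-- The Lie algebra of the inverse limit of the groups of truncated series. -/
noncomputable def limitEquiv :
    letI := fun r => O.truncGroup r
    OperadSeries P ≃ₗ[𝕜] limitLieAlgebra (𝕜 := 𝕜) (E := TruncSeries P) (TruncSeries P)
      O.truncateSuccHom :=
  letI := fun r => O.truncGroup r
  LinearEquiv.ofBijective
    { toFun := fun f => ⟨fun r => truncate r f, fun r => mfderiv_truncateSucc r 0 (truncate (r + 1) f)⟩
      map_add' := fun f g => rfl
      map_smul' := fun c f => rfl }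
    ⟨fun f g h => by
        have h' : ∀ r, truncate r f = truncate r g := fun r => congrFun (congrArg Subtype.val h) r
        exact funext fun i => congrFun (h' (i + 1)) (Fin.last i),
      fun x => by
        obtain ⟨f, hf⟩ := exists_truncate_eq (x := x.1) fun r =>
          (mfderiv_truncateSucc r 0 (x.1 (r + 1))).symm.trans (x.2 r)
        exact ⟨f, Subtype.ext (funext hf)⟩⟩

end LieGroup

end SymmetricOperad

theorem mainTheorem4 :
    -- the algebraic part: `*` is a pre-Lie product on `L(P)` and its commutator a Lie bracket
    (∀ (k : Type u) [CommRing k] (P : ℕ → Type v) [∀ n, AddCommGroup (P n)]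
      [∀ n, Module k (P n)] (O : SymmetricOperad k P),
      (∀ f g : OperadSeries P,
        O.star (SymmetricOperad.lieSeq f) (SymmetricOperad.lieSeq g) =
          SymmetricOperad.lieSeq (O.preLie f g)) ∧
      (∀ (f g : OperadSeries P) (n : ℕ),
        O.star (SymmetricOperad.lieSeq f) (SymmetricOperad.lieSeq g) n =
          ∑ π : SetPart n with (π.parts.filter fun B => 1 < B.card).card = 1,
            O.partTerm π (SymmetricOperad.lieSeq g) (O.groupSeq f)) ∧
      (∃ B : OperadSeries P →ₗ[k] OperadSeries P →ₗ[k] OperadSeries P,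
        ∀ f g, B f g = O.preLie f g) ∧
      (∀ f g h : OperadSeries P,
        O.preLie (O.preLie f g) h - O.preLie f (O.preLie g h) =
          O.preLie (O.preLie g f) h - O.preLie g (O.preLie f h)) ∧
      (∀ f : OperadSeries P, O.bracket f f = 0) ∧
      (∀ f g h : OperadSeries P,
        O.bracket f (O.bracket g h) + O.bracket g (O.bracket h f) +
          O.bracket h (O.bracket f g) = 0)) ∧
    -- the Lie-theoretic part: `L(P)` is the Lie algebra of the pro-Lie group `H(P)`
    (∀ (𝕜 : Type u) [RCLike 𝕜] (P : ℕ → Type v) [∀ n, NormedAddCommGroup (P n)]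
      [∀ n, NormedSpace 𝕜 (P n)] [∀ n, FiniteDimensional 𝕜 (P n)] (O : SymmetricOperad 𝕜 P),
      ∃ (_ : Group (OperadSeries P)) (_ : ∀ r, Group (TruncSeries P r))
        (τ : ∀ r, OperadSeries P →* TruncSeries P r)
        (φ : ∀ r, TruncSeries P (r + 1) →* TruncSeries P r),
        (∀ g f : OperadSeries P,
          O.groupSeq (g * f) = O.bullet (O.groupSeq g) (O.groupSeq f)) ∧
        (∀ r f, τ r f = truncate r f) ∧
        (∀ r f, φ r f = truncateSucc r f) ∧
        (∀ r, Function.Surjective (τ r)) ∧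
        (∀ r f, f ∈ (τ r).ker ↔ ∀ i < r, f i = 0) ∧
        (∀ r, LieGroup 𝓘(𝕜, TruncSeries P r) ω (TruncSeries P r)) ∧
        IsTopologicalGroup (OperadSeries P) ∧
        Topology.IsEmbedding (fun (f : OperadSeries P) r => τ r f) ∧
        Set.range (fun (f : OperadSeries P) r => τ r f) = {x | ∀ r, φ r (x (r + 1)) = x r} ∧
        ∃ e : OperadSeries P ≃ₗ[𝕜] limitLieAlgebra (𝕜 := 𝕜) (E := TruncSeries P)
            (TruncSeries P) φ,
          (∀ f r, (e f).1 r = truncate r f) ∧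
          (∀ f g r, (e (O.bracket f g)).1 r = rightInvariantBracket ((e f).1 r) ((e g).1 r)) ∧
          (∀ f g r, (e (O.bracket f g)).1 r = -⁅(e f).1 r, (e g).1 r⁆)) := by
  refine ⟨fun k _ P _ _ O => ?_, fun 𝕜 _ P _ _ _ O => ?_⟩
  · refine ⟨O.star_lieSeq, fun f g n => O.star_eq_sum f _ n, ⟨O.preLieHom, O.preLieHom_apply⟩,
      O.preLie_identity, O.bracket_self, O.bracket_jacobi⟩
  · refine ⟨O.seriesGroup, fun r => O.truncGroup r, O.truncateHom, O.truncateSuccHom,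
      O.groupSeq_mul, fun _ _ => rfl, fun _ _ => rfl,
      SymmetricOperad.truncate_surjective, fun r f => ?_, O.lieGroup_trunc,
      O.isTopologicalGroup_series, SymmetricOperad.isEmbedding_truncate, ?_,
      O.limitEquiv, fun _ _ => rfl, fun f g r => ?_, fun f g r => ?_⟩
    · let := O.seriesGroup
      let := O.truncGroup r
      exact MonoidHom.mem_ker.trans (SymmetricOperad.truncate_eq_iff (f' := 0))
    · ext x
      constructor
      · rintro ⟨f, rfl⟩ r
        rfl
      · intro hx
        obtain ⟨f, hf⟩ := SymmetricOperad.exists_truncate_eq hx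
        exact ⟨f, funext hf⟩
    -- The bracket at level `r` was computed on extensions by zero; these have the same truncated
    -- bracket as `f` and `g`.
    · exact (O.truncate_bracket_extend r f g).symm.trans
        (O.rightInvariantBracket_trunc r (truncate r f) (truncate r g)).symm
    · exact ((O.truncate_bracket_extend r f g).symm.trans (neg_neg _).symm).trans
        (congrArg (fun x : TruncSeries P r => -x)
          (O.leftInvariantBracket_trunc r (truncate r f) (truncate r g)).symm)
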